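/- Let $(N,g_N)$ be a connected, orientable, closed Riemannian $n$-manifold that is Einstein (i.e. $\mathrm{Ric}_{g_N}=c\,g_N$ for a constant $c$) with scalar curvature $R^*<0$, and let $(M,g_M)$ be an orientable closed Riemannian $n$-manifold with $\mathrm{Sc}_{g_M}\ge R^*$ everywhere. Let $f\colon M\to N$ be a smooth map of non-zero degree (for some choice of orientations of $M$ and $N$) which is $1$-expansive, i.e. $|f_*v|_{g_N}\ge |v|_{g_M}$ for all $v\in TM$, and harmonic, i.e. its tension field $\operatorname{tr}_{g_M}\nabla df$ vanishes. For local orthonormal frames $(e_i)$ of $TM$ and $(e^*_a)$ of $TN$ write $f_*e_i=\sum_a A^a_i e^*_a$ and $(\nabla df)(e_i,e_j)=\sum_a A^a_{ij}e^*_a$, let $(B^i_a)=\operatorname{adj}(A^a_i)$ be the adjugate matrix (so $B=\det(A)\,A^{-1}$ where $A$ is invertible), and let $$C=\sum_{i,j,k,a,b} B^i_a\,A^a_{kj}\,B^k_b\,A^b_{ij},$$ a function on $M$ that does not depend on the choice of the frames. If $C\le 0$ on $M$, then $f$ is a local isometry, i.e. a local diffeomorphism with $f^*g_N=g_M$. 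-/

import Mathlib

open scoped Manifold ContDiff Topology

noncomputable section

namespace EinsteinRigidity

/-- The Euclidean model space. -/
abbrev E (n : ℕ) : Type := EuclideanSpace ℝ (Fin n)

/-- A smooth Riemannian metric on a boundaryless `n`-manifold. -/
abbrev Metric (n : ℕ) (M : Type*) [TopologicalSpace M] [ChartedSpace (E n) M]
    [IsManifold (𝓡 n) ∞ M] :=
  Bundle.ContMDiffRiemannianMetric (𝓡 n) ∞ (E n) (fun x : M ↦ TangentSpace (𝓡 n) x)

/-- The partial derivative `∂ᵢ φ (u)` of a real function on the model space. -/
def pderiv {n : ℕ} (i : Fin n) (φ : E n → ℝ) (u : E n) : ℝ :=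
  fderiv ℝ φ u (EuclideanSpace.single i 1)

section Curvature

variable {n : ℕ} {M : Type*} [TopologicalSpace M] [ChartedSpace (E n) M] [IsManifold (𝓡 n) ∞ M]

/-- The length `|v|_g` of a tangent vector `v` at `x`. -/
def tangentNorm (g : Metric n M) (x : M) (v : TangentSpace (𝓡 n) x) : ℝ :=
  Real.sqrt (g.inner x v v)

/-- The matrix `(g_{ij})` of the metric in the preferred chart around `p`, at the point with
coordinates `u`. -/
def gram (g : Metric n M) (p : M) (u : E n) : Matrix (Fin n) (Fin n) ℝ :=
  Matrix.of fun i j ↦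
    g.inner ((extChartAt (𝓡 n) p).symm u)
      (mfderiv 𝓘(ℝ, E n) (𝓡 n) (extChartAt (𝓡 n) p).symm u (EuclideanSpace.single i 1))
      (mfderiv 𝓘(ℝ, E n) (𝓡 n) (extChartAt (𝓡 n) p).symm u (EuclideanSpace.single j 1))

/-- The Christoffel symbol `Γ^k_{ij}` of the Levi-Civita connection in the preferred chart
around `p`. -/
def christoffel (g : Metric n M) (p : M) (k i j : Fin n) (u : E n) : ℝ :=
  (1 / 2) * ∑ l, (gram g p u)⁻¹ k l *
    (pderiv i (fun w ↦ gram g p w j l) u + pderiv j (fun w ↦ gram g p w i l) u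
      - pderiv l (fun w ↦ gram g p w i j) u)

/-- The components `Ric_{jk}` of the Ricci tensor at `p`, in the preferred chart at `p` (the sign
is such that round spheres have positive Ricci curvature). -/
def ricci (g : Metric n M) (p : M) : Matrix (Fin n) (Fin n) ℝ :=
  Matrix.of fun j k ↦
    let u := extChartAt (𝓡 n) p p
    ∑ l, (pderiv l (christoffel g p l j k) u - pderiv j (christoffel g p l l k) u
      + ∑ m, (christoffel g p l l m u * christoffel g p m j k u
        - christoffel g p l j m u * christoffel g p m l k u))

/-- The scalar curvature at `p`: the `g`-trace of the Ricci tensor. -/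
def scalarCurvature (g : Metric n M) (p : M) : ℝ :=
  ∑ j, ∑ k, (gram g p (extChartAt (𝓡 n) p p))⁻¹ j k * ricci g p j k

/-- The metric is Einstein: `Ric = c g` for a constant `c`. -/
def IsEinstein (g : Metric n M) : Prop :=
  ∃ c : ℝ, ∀ p : M, ricci g p = c • gram g p (extChartAt (𝓡 n) p p)

end Curvature

section Degree

/-- `L` is a linear isomorphism that carries the orientation `oV` to the orientation `oW`. -/
def CarriesOrientation {n : ℕ} {V W : Type*} [AddCommGroup V] [Module ℝ V] [AddCommGroup W]
    [Module ℝ W] (L : V →ₗ[ℝ] W) (oV : Orientation ℝ V (Fin n)) (oW : Orientation ℝ W (Fin n)) :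
    Prop :=
  ∃ e : V ≃ₗ[ℝ] W, (e : V →ₗ[ℝ] W) = L ∧ Orientation.map (Fin n) e oV = oW

/-- An orientation of a manifold: an orientation of every tangent space, such that in the preferred
chart around every point it is constant near this point. -/
structure ManifoldOrientation (n : ℕ) (M : Type*) [TopologicalSpace M] [ChartedSpace (E n) M] where
  /-- the orientation of the tangent space at a point -/
  at_point : ∀ x : M, Orientation ℝ (TangentSpace (𝓡 n) x) (Fin n)
  locally_const : ∀ p : M, ∃ o : Orientation ℝ (E n) (Fin n), ∀ᶠ x in 𝓝 p,
    CarriesOrientation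
      (mfderiv (𝓡 n) 𝓘(ℝ, E n) (extChartAt (𝓡 n) p) x).toLinearMap (at_point x) o

variable {n : ℕ} {M N : Type*} [TopologicalSpace M] [ChartedSpace (E n) M]
  [TopologicalSpace N] [ChartedSpace (E n) N]

/-- `y` is a regular value of `f` (a map between manifolds of the same dimension). -/
def IsRegularValue (f : M → N) (y : N) : Prop :=
  ∀ x : M, f x = y → Function.Bijective (mfderiv (𝓡 n) (𝓡 n) f x)

open Classical in
/-- The sign `±1` of the differential of `f` at `x`, where it is invertible. -/
def orientationSign (oM : ManifoldOrientation n M) (oN : ManifoldOrientation n N) (f : M → N)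
    (x : M) : ℤ :=
  if CarriesOrientation (mfderiv (𝓡 n) (𝓡 n) f x).toLinearMap (oM.at_point x) (oN.at_point (f x))
  then 1 else -1

/-- The smooth map `f` from a closed oriented manifold to a connected closed oriented manifold of
the same dimension has degree `d`: the signed number of preimages of every regular value is `d`. -/
def HasDegree (oM : ManifoldOrientation n M) (oN : ManifoldOrientation n N) (f : M → N)
    (d : ℤ) : Prop :=
  ∀ y : N, IsRegularValue (n := n) f y → ∑ᶠ (x : M) (_ : f x = y), orientationSign oM oN f x = d

end Degree

section Maps

variable {n : ℕ} {M N : Type*} [TopologicalSpace M] [ChartedSpace (E n) M] [IsManifold (𝓡 n) ∞ M]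
  [TopologicalSpace N] [ChartedSpace (E n) N] [IsManifold (𝓡 n) ∞ N]

/-- `f` is 1-expansive: `|f_* v| ≥ |v|` for every tangent vector `v`. -/
def IsOneExpansive (gM : Metric n M) (gN : Metric n N) (f : M → N) : Prop :=
  ∀ (x : M) (v : TangentSpace (𝓡 n) x),
    tangentNorm gM x v ≤ tangentNorm gN (f x) (mfderiv (𝓡 n) (𝓡 n) f x v)

/-- The `a`-th component of `f` in the preferred charts around `p` and `f p`. -/
def mapComponent (f : M → N) (p : M) (a : Fin n) (u : E n) : ℝ :=
  writtenInExtChartAt (𝓡 n) (𝓡 n) p f u a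

/-- The matrix `A^a_i = ∂ᵢ f^a` of the differential of `f` at `p`, in the preferred charts at `p`
and `f p`. -/
def jacobian (f : M → N) (p : M) : Matrix (Fin n) (Fin n) ℝ :=
  Matrix.of fun a i ↦ pderiv i (mapComponent f p a) (extChartAt (𝓡 n) p p)

/-- The covariant derivative `∇_j df` at `p`, as the matrix with the entries
`A^a_{ij} = ∂ᵢ∂ⱼ f^a - Γ^k_{ij} ∂ₖ f^a + Γ'^a_{bc} ∂ᵢ f^b ∂ⱼ f^c` (`a` the row, `i` the column),
in the preferred charts at `p` and `f p`. -/
def covDerivDiff (gM : Metric n M) (gN : Metric n N) (f : M → N) (p : M) (j : Fin n) :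
    Matrix (Fin n) (Fin n) ℝ :=
  Matrix.of fun a i ↦
    let u := extChartAt (𝓡 n) p p
    let v := extChartAt (𝓡 n) (f p) (f p)
    pderiv i (pderiv j (mapComponent f p a)) u
      - ∑ k, christoffel gM p k i j u * jacobian f p a k
      + ∑ b, ∑ c, christoffel gN (f p) a b c v * jacobian f p b i * jacobian f p c j

/-- `f` is harmonic: its tension field `τ^a = g^{ij} A^a_{ij}` vanishes. -/
def IsHarmonic (gM : Metric n M) (gN : Metric n N) (f : M → N) : Prop :=
  ∀ (p : M) (a : Fin n),
    ∑ i, ∑ j, (gram gM p (extChartAt (𝓡 n) p p))⁻¹ i j * covDerivDiff gM gN f p j a i = 0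

/-- The scalar invariant `C` of `f` from the formula
`½ Δ V = 2 ∑ⱼ (𝔸_j)² + V (Sc - ∑ R*_{bc} A^b_j A^c_j) - C` for harmonic `f`, where
`V = 𝔸²` is the squared Jacobian. In orthonormal frames at `p` and `f p`,
`C = ∑ⱼ tr (adj A ⬝ ∇_j A ⬝ adj A ⬝ ∇_j A)`, with `adj A` the matrix of cofactors (transposed) of
`A`; where `df` is invertible this is `V ∑ⱼ tr ((df⁻¹ ∘ ∇_j df)²)`. Below is the same number in
coordinate frames; the factor `det g_N / det g_M` makes it independent of the charts. -/
def invariantC (gM : Metric n M) (gN : Metric n N) (f : M → N) (p : M) : ℝ :=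
  let G := gram gM p (extChartAt (𝓡 n) p p)
  let H := gram gN (f p) (extChartAt (𝓡 n) (f p) (f p))
  let B := (jacobian f p).adjugate
  H.det / G.det * ∑ j, ∑ l, G⁻¹ j l *
    (B * covDerivDiff gM gN f p j * B * covDerivDiff gM gN f p l).trace

/-- `f` is a local isometry: a local diffeomorphism that pulls `gN` back to `gM`. -/
def IsLocalIsometry (gM : Metric n M) (gN : Metric n N) (f : M → N) : Prop :=
  IsLocalDiffeomorph (𝓡 n) (𝓡 n) ∞ f ∧
    ∀ (x : M) (v w : TangentSpace (𝓡 n) x),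
      gN.inner (f x) (mfderiv (𝓡 n) (𝓡 n) f x v) (mfderiv (𝓡 n) (𝓡 n) f x w) = gM.inner x v w

end Maps

end EinsteinRigidity

end

noncomputable section

namespace EinsteinRigidity

/-! ### Coordinate calculus of scalar and matrix-valued functions, up to Jacobi's formula. -/

section LocalCalculus

variable {n : ℕ}

/-! ### Partial derivatives of scalar functions -/

/-! The proof is a maximum principle for the squared Jacobian V = det(f^*g_N) / det(g_M).
Expansiveness makes df injective, so V > 0 and W = log V is smooth. In charts, with J = df and A_j =
∇_j df, one has ∂_j W = 2 tr(J⁻¹ A_j) (`pderiv_log_density`).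

Differentiating once more, commuting covariant derivatives by the Ricci identity (`covD_comm`) and
using that the tension field vanishes near the point, one obtains at a critical point of W
(`bochner_formula`) ½ ΔW = Sc_M - tr_{g_M}(f^*Ric_N) - g^{lj} tr(J⁻¹ A_l J⁻¹ A_j). The last sum is C
divided by V, hence nonpositive. At a maximum of W the left side is nonpositive
(`curvature_inequality_of_isLocalMax`), so Sc_M ≤ tr_{g_M}(f^*Ric_N) there.

With Ric_N = c g_N, the trace gives cn = R* < 0, so cn ≤ Sc_M ≤ c tr_{g_M}(f^*g_N), and dividing by
c < 0 gives tr_{g_M}(f^*g_N) ≤ n. Expansiveness says f^*g_N ≥ g_M, so the two forms agree at the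
maximum (`eq_of_trace_inv_mul_le`) and max V = 1. Therefore V ≤ 1 everywhere, and f^*g_N ≥ g_M with
no larger determinant forces f^*g_N = g_M at every point (`eq_of_det_le`). The inverse function
theorem supplies the local diffeomorphism. -/

theorem pderiv_congr {φ ψ : E n → ℝ} {u : E n} (h : φ =ᶠ[𝓝 u] ψ) (i : Fin n) :
    pderiv i φ u = pderiv i ψ u := by
  unfold pderiv
  rw [h.fderiv_eq]

theorem pderiv_const (c : ℝ) (u : E n) (i : Fin n) : pderiv i (fun _ ↦ c) u = 0 := by
  simp [pderiv]

theorem pderiv_add {φ ψ : E n → ℝ} {u : E n} (hφ : DifferentiableAt ℝ φ u)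
    (hψ : DifferentiableAt ℝ ψ u) (i : Fin n) :
    pderiv i (fun w ↦ φ w + ψ w) u = pderiv i φ u + pderiv i ψ u := by
  simp [pderiv, fderiv_fun_add hφ hψ]

theorem pderiv_sub {φ ψ : E n → ℝ} {u : E n} (hφ : DifferentiableAt ℝ φ u)
    (hψ : DifferentiableAt ℝ ψ u) (i : Fin n) :
    pderiv i (fun w ↦ φ w - ψ w) u = pderiv i φ u - pderiv i ψ u := by
  simp [pderiv, fderiv_fun_sub hφ hψ]

theorem pderiv_mul {φ ψ : E n → ℝ} {u : E n} (hφ : DifferentiableAt ℝ φ u)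
    (hψ : DifferentiableAt ℝ ψ u) (i : Fin n) :
    pderiv i (fun w ↦ φ w * ψ w) u = pderiv i φ u * ψ u + φ u * pderiv i ψ u := by
  simp [pderiv, fderiv_fun_mul hφ hψ]
  ring

theorem pderiv_sum {ι : Type*} {s : Finset ι} {φ : ι → E n → ℝ} {u : E n}
    (hφ : ∀ k ∈ s, DifferentiableAt ℝ (φ k) u) (i : Fin n) :
    pderiv i (fun w ↦ ∑ k ∈ s, φ k w) u = ∑ k ∈ s, pderiv i (φ k) u := by
  simp [pderiv, fderiv_fun_sum hφ]

theorem contDiffAt_pderiv {φ : E n → ℝ} {u : E n} (hφ : ContDiffAt ℝ ∞ φ u) (i : Fin n) :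
    ContDiffAt ℝ ∞ (pderiv i φ) u := by
  have h : ContDiffAt ℝ ∞ (fderiv ℝ φ) u := hφ.fderiv_right (by simp)
  exact h.clm_apply contDiffAt_const

theorem pderiv_pderiv_eq {φ : E n → ℝ} {u : E n} (h : DifferentiableAt ℝ (fderiv ℝ φ) u)
    (i j : Fin n) : pderiv i (pderiv j φ) u =
      fderiv ℝ (fderiv ℝ φ) u (EuclideanSpace.single i 1) (EuclideanSpace.single j 1) := by
  unfold pderiv
  rw [fderiv_clm_apply h (differentiableAt_const _)]
  simp

theorem pderiv_comm {φ : E n → ℝ} {u : E n} (hφ : ContDiffAt ℝ ∞ φ u) (i j : Fin n) :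
    pderiv i (pderiv j φ) u = pderiv j (pderiv i φ) u := by
  have h : DifferentiableAt ℝ (fderiv ℝ φ) u :=
    (hφ.fderiv_right (m := ∞) (by simp)).differentiableAt (by simp)
  have h2 : (2 : WithTop ℕ∞) ≤ ∞ := WithTop.coe_le_coe.2 (le_top : (2 : ℕ∞) ≤ ⊤)
  rw [pderiv_pderiv_eq h, pderiv_pderiv_eq h]
  exact (hφ.isSymmSndFDerivAt (by simpa using h2)).eq _ _

theorem contDiffAt_apply_euclidean {φ : E n → E n} {u : E n} (hφ : ContDiffAt ℝ ∞ φ u)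
    (a : Fin n) : ContDiffAt ℝ ∞ (fun w ↦ φ w a) u :=
  (EuclideanSpace.proj a : E n →L[ℝ] ℝ).contDiff.contDiffAt.comp u hφ

/-- The Jacobian matrix of a map between coordinate domains. -/
def jac (φ : E n → E n) (u : E n) : Matrix (Fin n) (Fin n) ℝ :=
  Matrix.of fun a i ↦ pderiv i (fun w ↦ φ w a) u

theorem fderiv_single_apply {φ : E n → E n} {u : E n} (hφ : DifferentiableAt ℝ φ u)
    (a i : Fin n) : fderiv ℝ φ u (EuclideanSpace.single i 1) a = jac φ u a i := by
  have h : HasFDerivAt (fun w ↦ φ w a)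
      ((EuclideanSpace.proj a : E n →L[ℝ] ℝ).comp (fderiv ℝ φ u)) u :=
    (EuclideanSpace.proj a : E n →L[ℝ] ℝ).hasFDerivAt.comp u hφ.hasFDerivAt
  simp [jac, pderiv, h.fderiv]

theorem fderiv_single {φ : E n → E n} {u : E n} (hφ : DifferentiableAt ℝ φ u) (i : Fin n) :
    fderiv ℝ φ u (EuclideanSpace.single i 1) =
      ∑ a, jac φ u a i • EuclideanSpace.single a (1 : ℝ) := by
  ext b
  rw [fderiv_single_apply hφ]
  simp [Finset.sum_apply, Pi.single_apply]

theorem pderiv_comp {h : E n → ℝ} {φ : E n → E n} {u : E n}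
    (hh : DifferentiableAt ℝ h (φ u)) (hφ : DifferentiableAt ℝ φ u) (j : Fin n) :
    pderiv j (fun w ↦ h (φ w)) u = ∑ c, jac φ u c j * pderiv c h (φ u) := by
  have : fderiv ℝ (fun w ↦ h (φ w)) u = (fderiv ℝ h (φ u)).comp (fderiv ℝ φ u) :=
    fderiv_comp u hh hφ
  simp [pderiv, this, fderiv_single hφ]

/-! ### Matrix-valued functions -/

/-- The entrywise partial derivative of a matrix-valued function. -/
def dmat (j : Fin n) (F : E n → Matrix (Fin n) (Fin n) ℝ) (u : E n) :
    Matrix (Fin n) (Fin n) ℝ :=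
  Matrix.of fun a b ↦ pderiv j (fun w ↦ F w a b) u

/-- Entrywise smoothness of a matrix-valued function at a point. -/
def SmoothMat (F : E n → Matrix (Fin n) (Fin n) ℝ) (u : E n) : Prop :=
  ∀ a b, ContDiffAt ℝ ∞ (fun w ↦ F w a b) u

variable {F K : E n → Matrix (Fin n) (Fin n) ℝ} {u : E n}

theorem SmoothMat.differentiableAt (h : SmoothMat F u) (a b : Fin n) :
    DifferentiableAt ℝ (fun w ↦ F w a b) u :=
  (h a b).differentiableAt (by simp)

theorem SmoothMat.add (hF : SmoothMat F u) (hK : SmoothMat K u) :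
    SmoothMat (fun w ↦ F w + K w) u := fun a b ↦ (hF a b).add (hK a b)

theorem SmoothMat.sub (hF : SmoothMat F u) (hK : SmoothMat K u) :
    SmoothMat (fun w ↦ F w - K w) u := fun a b ↦ (hF a b).sub (hK a b)

theorem SmoothMat.mul (hF : SmoothMat F u) (hK : SmoothMat K u) :
    SmoothMat (fun w ↦ F w * K w) u := fun a b ↦ by
  simp only [Matrix.mul_apply]
  exact ContDiffAt.sum fun c _ ↦ (hF a c).mul (hK c b)

theorem SmoothMat.transpose (hF : SmoothMat F u) : SmoothMat (fun w ↦ (F w).transpose) u :=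
  fun a b ↦ hF b a

theorem SmoothMat.smul {h : E n → ℝ} (hh : ContDiffAt ℝ ∞ h u) (hF : SmoothMat F u) :
    SmoothMat (fun w ↦ h w • F w) u := fun a b ↦ hh.mul (hF a b)

theorem SmoothMat.sum {ι : Type*} {s : Finset ι} {F : ι → E n → Matrix (Fin n) (Fin n) ℝ}
    (hF : ∀ k ∈ s, SmoothMat (F k) u) : SmoothMat (fun w ↦ ∑ k ∈ s, F k w) u := fun a b ↦ by
  simp only [Matrix.sum_apply]
  exact ContDiffAt.sum fun k hk ↦ hF k hk a b

theorem SmoothMat.dmat (hF : SmoothMat F u) (j : Fin n) : SmoothMat (dmat j F) u :=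
  fun a b ↦ contDiffAt_pderiv (hF a b) j

theorem SmoothMat.comp {φ : E n → E n} (hF : SmoothMat F (φ u)) (hφ : ContDiffAt ℝ ∞ φ u) :
    SmoothMat (fun w ↦ F (φ w)) u := fun a b ↦
  ContDiffAt.comp (g := fun w ↦ F w a b) u (hF a b) hφ

theorem SmoothMat.det (hF : SmoothMat F u) : ContDiffAt ℝ ∞ (fun w ↦ (F w).det) u := by
  simp only [Matrix.det_apply]
  exact ContDiffAt.sum fun σ _ ↦ (contDiffAt_prod fun i _ ↦ hF _ _).const_smul _

theorem SmoothMat.inv (hF : SmoothMat F u) (h : (F u).det ≠ 0) :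
    SmoothMat (fun w ↦ (F w)⁻¹) u := by
  intro a b
  have hadj : ContDiffAt ℝ ∞ (fun w ↦ (F w).adjugate a b) u := by
    simp only [Matrix.adjugate_apply]
    -- An entry of the adjugate is a determinant with one row replaced by a constant one.
    refine SmoothMat.det (F := fun w ↦ (F w).updateRow b (Pi.single a 1)) fun c e ↦ ?_
    by_cases hc : c = b
    · subst hc
      simpa using contDiffAt_const
    · simpa [Matrix.updateRow_ne hc] using hF c e
  simp only [Matrix.inv_def, Ring.inverse_eq_inv', Matrix.smul_apply, smul_eq_mul]
  exact (hF.det.inv h).mul hadj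

theorem smoothMat_jac {φ : E n → E n} (hφ : ContDiffAt ℝ ∞ φ u) : SmoothMat (jac φ) u :=
  fun a i ↦ contDiffAt_pderiv (contDiffAt_apply_euclidean hφ a) i

theorem dmat_congr (h : F =ᶠ[𝓝 u] K) (j : Fin n) : dmat j F u = dmat j K u := by
  ext a b
  exact pderiv_congr (h.mono fun w hw ↦ by simp [hw]) j

theorem dmat_add (hF : SmoothMat F u) (hK : SmoothMat K u) (j : Fin n) :
    dmat j (fun w ↦ F w + K w) u = dmat j F u + dmat j K u := by
  ext a b
  exact pderiv_add (hF.differentiableAt a b) (hK.differentiableAt a b) j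

theorem dmat_sub (hF : SmoothMat F u) (hK : SmoothMat K u) (j : Fin n) :
    dmat j (fun w ↦ F w - K w) u = dmat j F u - dmat j K u := by
  ext a b
  exact pderiv_sub (hF.differentiableAt a b) (hK.differentiableAt a b) j

theorem dmat_mul (hF : SmoothMat F u) (hK : SmoothMat K u) (j : Fin n) :
    dmat j (fun w ↦ F w * K w) u = dmat j F u * K u + F u * dmat j K u := by
  ext a b
  simp only [dmat, Matrix.of_apply, Matrix.mul_apply, Matrix.add_apply]
  rw [pderiv_sum (φ := fun c w ↦ F w a c * K w c b)
    fun c _ ↦ (hF.differentiableAt a c).mul (hK.differentiableAt c b),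
    ← Finset.sum_add_distrib]
  exact Finset.sum_congr rfl fun c _ ↦
    pderiv_mul (hF.differentiableAt a c) (hK.differentiableAt c b) j

theorem dmat_transpose (j : Fin n) :
    dmat j (fun w ↦ (F w).transpose) u = (dmat j F u).transpose := rfl

theorem dmat_smul {h : E n → ℝ} (hh : ContDiffAt ℝ ∞ h u) (hF : SmoothMat F u) (j : Fin n) :
    dmat j (fun w ↦ h w • F w) u = pderiv j h u • F u + h u • dmat j F u := by
  ext a b
  exact pderiv_mul (hh.differentiableAt (by simp)) (hF.differentiableAt a b) j

theorem dmat_sum {ι : Type*} {s : Finset ι} {F : ι → E n → Matrix (Fin n) (Fin n) ℝ}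
    (hF : ∀ k ∈ s, SmoothMat (F k) u) (j : Fin n) :
    dmat j (fun w ↦ ∑ k ∈ s, F k w) u = ∑ k ∈ s, dmat j (F k) u := by
  ext a b
  simp only [dmat, Matrix.of_apply, Matrix.sum_apply]
  exact pderiv_sum (fun k hk ↦ (hF k hk).differentiableAt a b) j

theorem dmat_comp {φ : E n → E n} (hF : SmoothMat F (φ u)) (hφ : ContDiffAt ℝ ∞ φ u)
    (j : Fin n) : dmat j (fun w ↦ F (φ w)) u = ∑ c, jac φ u c j • dmat c F (φ u) := by
  ext a b
  simp only [dmat, Matrix.of_apply, Matrix.sum_apply, Matrix.smul_apply, smul_eq_mul]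
  exact pderiv_comp (hF.differentiableAt a b) (hφ.differentiableAt (by simp)) j

theorem dmat_comm (hF : SmoothMat F u) (i j : Fin n) :
    dmat i (dmat j F) u = dmat j (dmat i F) u := by
  ext a b
  exact pderiv_comm (hF a b) i j

theorem dmat_jac_symm {φ : E n → E n} (hφ : ContDiffAt ℝ ∞ φ u) (i j a : Fin n) :
    dmat i (jac φ) u a j = dmat j (jac φ) u a i :=
  pderiv_comm (φ := fun w ↦ φ w a) (contDiffAt_apply_euclidean hφ a) i j

/-- Differentiate F⁻¹F = 1, which holds on a neighbourhood because the determinant stays nonzero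
there. -/
theorem dmat_inv (hF : SmoothMat F u) (h : (F u).det ≠ 0) (j : Fin n) :
    dmat j (fun w ↦ (F w)⁻¹) u = -((F u)⁻¹ * dmat j F u * (F u)⁻¹) := by
  have hev : ∀ᶠ w in 𝓝 u, (F w).det ≠ 0 := hF.det.continuousAt.eventually_ne h
  have h1 : dmat j (fun w ↦ (F w)⁻¹ * F w) u = 0 := by
    rw [dmat_congr (K := fun _ ↦ 1) (hev.mono fun w hw ↦
      Matrix.nonsing_inv_mul _ (Ne.isUnit hw))]
    ext a b
    exact pderiv_const _ _ _
  rw [dmat_mul (hF.inv h) hF] at h1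
  have h2 : dmat j (fun w ↦ (F w)⁻¹) u * F u = -((F u)⁻¹ * dmat j F u) :=
    eq_neg_of_add_eq_zero_left h1
  rw [← Matrix.mul_nonsing_inv_cancel_right (F u) (dmat j (fun w ↦ (F w)⁻¹) u) (Ne.isUnit h), h2,
    Matrix.neg_mul]

theorem pderiv_trace (hF : SmoothMat F u) (j : Fin n) :
    pderiv j (fun w ↦ (F w).trace) u = (dmat j F u).trace := by
  simp only [Matrix.trace, Matrix.diag]
  exact pderiv_sum (fun a _ ↦ hF.differentiableAt a a) j

/-- Jacobi's formula. -/
theorem pderiv_det (hF : SmoothMat F u) (j : Fin n) :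
    pderiv j (fun w ↦ (F w).det) u = ((F u).adjugate * dmat j F u).trace := by
  have hd : ∀ a b, HasFDerivAt (fun w ↦ F w a b) (fderiv ℝ (fun w ↦ F w a b) u) u :=
    fun a b ↦ (hF.differentiableAt a b).hasFDerivAt
  have h : HasFDerivAt (fun w ↦ (F w).det) (∑ σ : Equiv.Perm (Fin n), Equiv.Perm.sign σ •
      ∑ i, (∏ k ∈ Finset.univ.erase i, F u (σ k) k) • fderiv ℝ (fun w ↦ F w (σ i) i) u) u := by
    simp only [Matrix.det_apply]
    refine HasFDerivAt.fun_sum fun σ _ ↦ HasFDerivAt.const_smul ?_ _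
    exact HasFDerivAt.finsetProd fun i _ ↦ hd (σ i) i
  -- By Cramer's rule the i-th diagonal entry is the determinant of F with column i replaced by its
  -- derivative; expanding it gives the i-th term of the product rule.
  have key : ∀ i, ((F u).adjugate * dmat j F u) i i =
      ∑ σ : Equiv.Perm (Fin n), Equiv.Perm.sign σ •
        ((∏ k ∈ Finset.univ.erase i, F u (σ k) k) * dmat j F u (σ i) i) := by
    intro i
    have : ((F u).adjugate * dmat j F u) i i =
        ((F u).updateCol i (fun a ↦ dmat j F u a i)).det := by
      rw [← Matrix.cramer_apply, Matrix.cramer_eq_adjugate_mulVec]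
      rfl
    rw [this, Matrix.det_apply]
    refine Finset.sum_congr rfl fun σ _ ↦ ?_
    rw [← Finset.mul_prod_erase _ _ (Finset.mem_univ i), mul_comm]
    congr 2
    · exact Finset.prod_congr rfl fun k hk ↦ by
        rw [Matrix.updateCol_ne (Finset.ne_of_mem_erase hk)]
    · simp
  simp only [Matrix.trace, Matrix.diag, key]
  rw [Finset.sum_comm, pderiv, h.fderiv]
  simp [Finset.smul_sum, dmat, pderiv]

/-- `Real.log` depends only on the absolute value, so a nonzero determinant of either sign is
enough. -/
theorem pderiv_log_det (hF : SmoothMat F u) (h : (F u).det ≠ 0) (j : Fin n) :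
    pderiv j (fun w ↦ Real.log (F w).det) u = ((F u)⁻¹ * dmat j F u).trace := by
  have hd : DifferentiableAt ℝ (fun w ↦ (F w).det) u := hF.det.differentiableAt (by simp)
  have : pderiv j (fun w ↦ Real.log (F w).det) u =
      (F u).det⁻¹ * pderiv j (fun w ↦ (F w).det) u := by
    simp [pderiv, fderiv.log hd h]
  rw [this, pderiv_det hF, Matrix.inv_def, Ring.inverse_eq_inv', Matrix.smul_mul,
    Matrix.trace_smul, smul_eq_mul]

end LocalCalculus

/-! ### Levi-Civita connection, second fundamental form of a map, and coordinate changes. -/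

section LocalGeometry

variable {n : ℕ}

/-- Reordering that lets a metric contraction pass through a second pair of indices. -/
theorem sum_comm_pairs (f : Fin n → Fin n → Fin n → Fin n → ℝ) :
    ∑ i, ∑ j, ∑ k, ∑ c, f i j k c = ∑ k, ∑ c, ∑ j, ∑ i, f i j k c :=
  calc ∑ i, ∑ j, ∑ k, ∑ c, f i j k c = ∑ i, ∑ k, ∑ c, ∑ j, f i j k c :=
        Finset.sum_congr rfl fun i _ ↦ by
          rw [Finset.sum_comm]
          exact Finset.sum_congr rfl fun k _ ↦ Finset.sum_comm
    _ = ∑ k, ∑ c, ∑ j, ∑ i, f i j k c := by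
          rw [Finset.sum_comm]
          refine Finset.sum_congr rfl fun k _ ↦ ?_
          rw [Finset.sum_comm]
          exact Finset.sum_congr rfl fun c _ ↦ Finset.sum_comm

/-- The Christoffel symbols of a metric given by its coordinate matrix. -/
def chr (G : E n → Matrix (Fin n) (Fin n) ℝ) (k i j : Fin n) (u : E n) : ℝ :=
  (1 / 2) * ∑ l, (G u)⁻¹ k l *
    (pderiv i (fun w ↦ G w j l) u + pderiv j (fun w ↦ G w i l) u - pderiv l (fun w ↦ G w i j) u)

/-- The connection matrix `(Γ_j)^k_i = Γ^k_{ij}`. -/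
def chrMat (G : E n → Matrix (Fin n) (Fin n) ℝ) (j : Fin n) (u : E n) :
    Matrix (Fin n) (Fin n) ℝ :=
  Matrix.of fun k i ↦ chr G k i j u

/-- A coordinate expression of a smooth Riemannian metric near `u`. -/
structure IsMetricNear (G : E n → Matrix (Fin n) (Fin n) ℝ) (u : E n) : Prop where
  smooth : SmoothMat G u
  symm : ∀ᶠ w in 𝓝 u, (G w).IsSymm
  det_ne : (G u).det ≠ 0

variable {G H : E n → Matrix (Fin n) (Fin n) ℝ} {φ : E n → E n} {u : E n}

theorem SmoothMat.chrMat (hG : SmoothMat G u) (h : (G u).det ≠ 0) (j : Fin n) :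
    SmoothMat (chrMat G j) u := fun k i ↦ by
  refine contDiffAt_const.mul (ContDiffAt.sum fun l _ ↦ (hG.inv h k l).mul ?_)
  exact ((contDiffAt_pderiv (hG _ _) _).add (contDiffAt_pderiv (hG _ _) _)).sub
    (contDiffAt_pderiv (hG _ _) _)

theorem IsMetricNear.smooth_chrMat (hG : IsMetricNear G u) (j : Fin n) :
    SmoothMat (chrMat G j) u := hG.smooth.chrMat hG.det_ne j

theorem IsMetricNear.dmat_symm (hG : IsMetricNear G u) (j a b : Fin n) :
    dmat j G u a b = dmat j G u b a :=
  pderiv_congr (hG.symm.mono fun _ hw ↦ hw.apply b a) j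

theorem IsMetricNear.chr_symm (hG : IsMetricNear G u) (k i j : Fin n) :
    chr G k i j u = chr G k j i u := by
  have h : ∀ l, pderiv l (fun w ↦ G w i j) u = pderiv l (fun w ↦ G w j i) u :=
    fun l ↦ hG.dmat_symm l i j
  simp only [chr, h]
  congr 1
  refine Finset.sum_congr rfl fun l _ ↦ ?_
  ring

/-- Lowering the upper index cancels the inverse metric and leaves the Christoffel symbols of the
first kind. -/
theorem IsMetricNear.mul_chrMat (hG : IsMetricNear G u) (j m i : Fin n) :
    (G u * chrMat G j u) m i = (1 / 2) * (dmat i G u j m + dmat j G u i m - dmat m G u i j) := by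
  have h : chrMat G j u = (G u)⁻¹ * Matrix.of fun l i ↦
      (1 / 2) * (dmat i G u j l + dmat j G u i l - dmat l G u i j) := by
    ext k i
    simp only [chrMat, chr, Matrix.of_apply, Matrix.mul_apply, Finset.mul_sum, dmat]
    exact Finset.sum_congr rfl fun l _ ↦ by ring
  rw [h, Matrix.mul_nonsing_inv_cancel_left _ _ (Ne.isUnit hG.det_ne)]
  rfl

/-- Metric compatibility of the Levi-Civita connection. -/
theorem IsMetricNear.dmat_eq (hG : IsMetricNear G u) (j : Fin n) :
    dmat j G u = (chrMat G j u).transpose * G u + G u * chrMat G j u := by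
  have hs : (G u).transpose = G u := hG.symm.self_of_nhds
  have h : (chrMat G j u).transpose * G u = (G u * chrMat G j u).transpose := by
    rw [Matrix.transpose_mul, hs]
  ext a b
  rw [h, Matrix.add_apply, Matrix.transpose_apply, hG.mul_chrMat, hG.mul_chrMat,
    hG.dmat_symm j b a, hG.dmat_symm b a j, hG.dmat_symm a j b]
  ring

/-- Metric compatibility under the trace: the logarithmic derivative of det G is 2Γ^k_{kj}. -/
theorem IsMetricNear.trace_inv_mul_dmat (hG : IsMetricNear G u) (j : Fin n) :
    ((G u)⁻¹ * dmat j G u).trace = 2 * (chrMat G j u).trace := by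
  rw [hG.dmat_eq, Matrix.mul_add, Matrix.trace_add,
    Matrix.nonsing_inv_mul_cancel_left _ _ (Ne.isUnit hG.det_ne), Matrix.trace_mul_comm,
    Matrix.mul_nonsing_inv_cancel_right _ _ (Ne.isUnit hG.det_ne), Matrix.trace_transpose]
  ring

theorem IsMetricNear.dmat_inv_eq (hG : IsMetricNear G u) (j : Fin n) :
    dmat j (fun w ↦ (G w)⁻¹) u =
      -((G u)⁻¹ * (chrMat G j u).transpose + chrMat G j u * (G u)⁻¹) := by
  have h := Ne.isUnit hG.det_ne
  rw [dmat_inv hG.smooth hG.det_ne, hG.dmat_eq, Matrix.mul_add, Matrix.add_mul,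
    Matrix.nonsing_inv_mul_cancel_left _ _ h, ← Matrix.mul_assoc,
    Matrix.mul_nonsing_inv_cancel_right _ _ h]

/-- The pulled back connection matrix of the target metric. -/
def pullChr (H : E n → Matrix (Fin n) (Fin n) ℝ) (φ : E n → E n) (j : Fin n) (u : E n) :
    Matrix (Fin n) (Fin n) ℝ :=
  ∑ c, jac φ u c j • chrMat H c (φ u)

/-- The pulled back connection is compatible with the pulled back bundle metric, by the chain rule.
-/
theorem IsMetricNear.dmat_comp_eq (hH : IsMetricNear H (φ u)) (hφ : ContDiffAt ℝ ∞ φ u)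
    (j : Fin n) : dmat j (fun w ↦ H (φ w)) u =
      (pullChr H φ j u).transpose * H (φ u) + H (φ u) * pullChr H φ j u := by
  rw [dmat_comp hH.smooth hφ]
  simp only [pullChr, Matrix.transpose_sum, Matrix.transpose_smul, Finset.sum_mul,
    Finset.mul_sum, Matrix.smul_mul, Matrix.mul_smul, ← Finset.sum_add_distrib, ← smul_add]
  exact Finset.sum_congr rfl fun c _ ↦ by rw [hH.dmat_eq c]

/-- The covariant derivative `∇_j dφ` as a matrix. -/
def covM (G H : E n → Matrix (Fin n) (Fin n) ℝ) (φ : E n → E n) (j : Fin n) (u : E n) :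
    Matrix (Fin n) (Fin n) ℝ :=
  dmat j (jac φ) u - jac φ u * chrMat G j u + pullChr H φ j u * jac φ u

/-- The tension field in coordinates. -/
def tension (G H : E n → Matrix (Fin n) (Fin n) ℝ) (φ : E n → E n) (a : Fin n) (u : E n) : ℝ :=
  ∑ i, ∑ j, (G u)⁻¹ i j * covM G H φ j u a i

theorem smoothMat_pullChr (hφ : ContDiffAt ℝ ∞ φ u) (hH : IsMetricNear H (φ u)) (j : Fin n) :
    SmoothMat (pullChr H φ j) u :=
  SmoothMat.sum fun c _ ↦ SmoothMat.smul (smoothMat_jac hφ c j) ((hH.smooth_chrMat c).comp hφ)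

theorem smoothMat_covM (hG : IsMetricNear G u) (hφ : ContDiffAt ℝ ∞ φ u)
    (hH : IsMetricNear H (φ u)) (j : Fin n) : SmoothMat (covM G H φ j) u :=
  (((smoothMat_jac hφ).dmat j).sub ((smoothMat_jac hφ).mul (hG.smooth_chrMat j))).add
    ((smoothMat_pullChr hφ hH j).mul (smoothMat_jac hφ))

/-- Second partial derivatives commute and both connections are torsion free. -/
theorem covM_symm (hG : IsMetricNear G u) (hφ : ContDiffAt ℝ ∞ φ u)
    (hH : IsMetricNear H (φ u)) (i j a : Fin n) : covM G H φ j u a i = covM G H φ i u a j := by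
  have h1 : (jac φ u * chrMat G j u) a i = (jac φ u * chrMat G i u) a j := by
    simp only [Matrix.mul_apply, chrMat, Matrix.of_apply, hG.chr_symm _ i j]
  have h2 : (pullChr H φ j u * jac φ u) a i = (pullChr H φ i u * jac φ u) a j := by
    simp only [Matrix.mul_apply, pullChr, Matrix.sum_apply, Finset.sum_mul, Matrix.smul_apply,
      smul_eq_mul, chrMat, Matrix.of_apply]
    rw [Finset.sum_comm]
    refine Finset.sum_congr rfl fun c _ ↦ Finset.sum_congr rfl fun b _ ↦ ?_
    rw [hH.chr_symm]
    ring
  simp only [covM, Matrix.add_apply, Matrix.sub_apply, h1, h2, dmat_jac_symm hφ j i a]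

/-! ### Composition and isometries -/

theorem jac_comp {ψ : E n → E n} (hψ : ContDiffAt ℝ ∞ ψ (φ u)) (hφ : ContDiffAt ℝ ∞ φ u) :
    jac (fun w ↦ ψ (φ w)) u = jac ψ (φ u) * jac φ u := by
  ext a i
  simp only [jac, Matrix.of_apply, Matrix.mul_apply]
  rw [pderiv_comp (h := fun w ↦ ψ w a)
    ((contDiffAt_apply_euclidean hψ a).differentiableAt (by simp))
    (hφ.differentiableAt (by simp))]
  exact Finset.sum_congr rfl fun c _ ↦ mul_comm _ _

theorem jac_congr {ψ : E n → E n} (h : φ =ᶠ[𝓝 u] ψ) : jac φ u = jac ψ u := by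
  ext a i
  exact pderiv_congr (h.mono fun w hw ↦ by simp [hw]) i

theorem covM_congr {ψ : E n → E n} (h : φ =ᶠ[𝓝 u] ψ) (j : Fin n) :
    covM G H φ j u = covM G H ψ j u := by
  have h' : jac φ =ᶠ[𝓝 u] jac ψ := h.eventuallyEq_nhds.mono fun w hw ↦ jac_congr hw
  simp only [covM, pullChr, dmat_congr h', h'.self_of_nhds, h.self_of_nhds]

/-- The composition formula for the second fundamental form of maps. -/
theorem covM_comp {K : E n → Matrix (Fin n) (Fin n) ℝ} {ψ : E n → E n}
    (hψ : ∀ᶠ w in 𝓝 u, ContDiffAt ℝ ∞ ψ (φ w)) (hφ : ∀ᶠ w in 𝓝 u, ContDiffAt ℝ ∞ φ w)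
    (j : Fin n) :
    covM G K (fun w ↦ ψ (φ w)) j u =
      (∑ c, jac φ u c j • covM H K ψ c (φ u)) * jac φ u + jac ψ (φ u) * covM G H φ j u := by
  have hψ0 := hψ.self_of_nhds
  have hφ0 := hφ.self_of_nhds
  have hJ : jac (fun w ↦ ψ (φ w)) =ᶠ[𝓝 u] fun w ↦ jac ψ (φ w) * jac φ w :=
    hψ.mp (hφ.mono fun w h1 h2 ↦ jac_comp h2 h1)
  have hd : dmat j (jac fun w ↦ ψ (φ w)) u =
      (∑ c, jac φ u c j • dmat c (jac ψ) (φ u)) * jac φ u +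
        jac ψ (φ u) * dmat j (jac φ) u := by
    rw [dmat_congr hJ, dmat_mul ((smoothMat_jac hψ0).comp hφ0) (smoothMat_jac hφ0),
      dmat_comp (smoothMat_jac hψ0) hφ0]
  have hp : pullChr K (fun w ↦ ψ (φ w)) j u = ∑ c, jac φ u c j • pullChr K ψ c (φ u) := by
    simp only [pullChr, hJ.self_of_nhds, Matrix.mul_apply, Finset.sum_smul, Finset.smul_sum,
      smul_smul]
    rw [Finset.sum_comm]
    simp only [mul_comm]
  -- The connection of the intermediate metric H enters the two summands with opposite signs and
  -- cancels.
  have hm : jac ψ (φ u) * pullChr H φ j u =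
      ∑ c, jac φ u c j • (jac ψ (φ u) * chrMat H c (φ u)) := by
    simp only [pullChr, Finset.mul_sum, Matrix.mul_smul]
  have hs : (∑ c, jac φ u c j • (pullChr K ψ c (φ u) * jac ψ (φ u))) =
      (∑ c, jac φ u c j • pullChr K ψ c (φ u)) * jac ψ (φ u) := by
    simp only [Finset.sum_mul, Matrix.smul_mul]
  simp only [covM, smul_add, smul_sub, Finset.sum_add_distrib, Finset.sum_sub_distrib, hd, hp,
    hJ.self_of_nhds, ← hm, hs]
  noncomm_ring

/-- Isometries are totally geodesic. -/
theorem covM_eq_zero_of_isometry (hG : IsMetricNear G u) (hφ : ContDiffAt ℝ ∞ φ u)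
    (hH : IsMetricNear H (φ u))
    (hiso : ∀ᶠ w in 𝓝 u, G w = (jac φ w).transpose * H (φ w) * jac φ w) (j : Fin n) :
    covM G H φ j u = 0 := by
  have hJ := smoothMat_jac hφ
  have hHs : (H (φ u)).transpose = H (φ u) := hH.symm.self_of_nhds
  have hG0 := hiso.self_of_nhds
  set J := jac φ u with hJdef
  set P := H (φ u) with hP
  have hdet : J.det ≠ 0 := fun h ↦ hG.det_ne (by rw [hG0]; simp [h])
  have hunit : IsUnit (J.transpose * P).det := by
    rw [Matrix.det_mul, Matrix.det_transpose]
    exact (Ne.isUnit hdet).mul (Ne.isUnit hH.det_ne)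
  -- The second fundamental form paired with dφ, all indices lowered. Differentiating the isometry
  -- equation makes it skew in its matrix indices, while `covM_symm` makes it symmetric in direction
  -- and column; only zero has both symmetries.
  set L : Fin n → Matrix (Fin n) (Fin n) ℝ := fun j ↦ J.transpose * P * covM G H φ j u with hL
  have hanti : ∀ j, (L j).transpose + L j = 0 := by
    intro j
    have hdH := hH.dmat_comp_eq hφ j
    have h := hG.dmat_eq j
    rw [dmat_congr hiso, dmat_mul (hJ.transpose.mul (hH.smooth.comp hφ)) hJ,
      dmat_mul hJ.transpose (hH.smooth.comp hφ), dmat_transpose, hdH, hG0] at h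
    simp only [hL, covM, Matrix.transpose_mul, Matrix.transpose_transpose, Matrix.transpose_add,
      Matrix.transpose_sub, hHs, ← hJdef]
    rw [← sub_eq_zero] at h
    rw [← h]
    noncomm_ring
  have hsymm : ∀ i j m, L j m i = L i m j := by
    intro i j m
    simp only [hL, Matrix.mul_apply, covM_symm hG hφ hH i j]
  have hzero : L j = 0 := by
    ext m i
    have ha : ∀ j m i, L j i m + L j m i = 0 := fun j m i ↦ congrFun (congrFun (hanti j) m) i
    simp only [Matrix.zero_apply]
    linarith [ha j m i, ha m j i, ha i j m, hsymm i j m, hsymm j m i, hsymm m i j, hsymm m j i,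
      hsymm i m j, hsymm j i m]
  have := congrArg (fun X ↦ (J.transpose * P)⁻¹ * X) hzero
  simpa [hL, Matrix.nonsing_inv_mul_cancel_left _ _ hunit] using this

/-- The vanishing of the tension field is invariant under isometric coordinate changes of the source
and the target. -/
theorem tension_eq_zero_of_change {G' H' : E n → Matrix (Fin n) (Fin n) ℝ}
    {φ' ψ χ : E n → E n}
    (hG : IsMetricNear G u) (hG' : IsMetricNear G' (ψ u)) (hH : IsMetricNear H (φ u))
    (hH' : IsMetricNear H' (χ (φ u)))
    (hφ : ∀ᶠ w in 𝓝 u, ContDiffAt ℝ ∞ φ w) (hψ : ∀ᶠ w in 𝓝 u, ContDiffAt ℝ ∞ ψ w)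
    (hχ : ∀ᶠ w in 𝓝 (φ u), ContDiffAt ℝ ∞ χ w) (hφ' : ∀ᶠ w in 𝓝 (ψ u), ContDiffAt ℝ ∞ φ' w)
    (hcomm : ∀ᶠ w in 𝓝 u, χ (φ w) = φ' (ψ w))
    (hψiso : ∀ᶠ w in 𝓝 u, G w = (jac ψ w).transpose * G' (ψ w) * jac ψ w)
    (hχiso : ∀ᶠ w in 𝓝 (φ u), H w = (jac χ w).transpose * H' (χ w) * jac χ w)
    (hτ : ∀ a, tension G' H' φ' a (ψ u) = 0) (a : Fin n) : tension G H φ a u = 0 := by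
  have hφ0 := hφ.self_of_nhds
  have hψ0 := hψ.self_of_nhds
  -- Apply the composition formula to both sides of χ ∘ φ = φ' ∘ ψ; the terms of χ and ψ drop out
  -- because isometries are totally geodesic.
  have hkey : ∀ j, jac χ (φ u) * covM G H φ j u =
      (∑ c, jac ψ u c j • covM G' H' φ' c (ψ u)) * jac ψ u := by
    intro j
    have h1 := covM_comp (G := G) (H := H) (K := H') (hφ0.continuousAt.eventually hχ) hφ j
    have h2 := covM_comp (G := G) (H := G') (K := H') (hψ0.continuousAt.eventually hφ') hψ j
    rw [covM_congr hcomm, h2, covM_eq_zero_of_isometry hG hψ0 hG' hψiso] at h1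
    simp only [covM_eq_zero_of_isometry hH hχ.self_of_nhds hH' hχiso, smul_zero,
      Finset.sum_const_zero, Matrix.zero_mul, Matrix.mul_zero, add_zero, zero_add] at h1
    exact h1.symm
  have hψdet : (jac ψ u).det ≠ 0 := fun h ↦
    hG.det_ne (by rw [hψiso.self_of_nhds]; simp [h])
  have hχdet : (jac χ (φ u)).det ≠ 0 := fun h ↦
    hH.det_ne (by rw [hχiso.self_of_nhds]; simp [h])
  -- The inverse metric is a contravariant tensor, so the two factors of dψ from `hkey` and its
  -- column index are absorbed.
  have hGinv : jac ψ u * (G u)⁻¹ * (jac ψ u).transpose = (G' (ψ u))⁻¹ := by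
    have h1 := Ne.isUnit hψdet
    have h2 : IsUnit (jac ψ u).transpose.det := by rwa [Matrix.det_transpose]
    rw [hψiso.self_of_nhds, Matrix.mul_inv_rev, Matrix.mul_inv_rev, ← Matrix.mul_assoc,
      ← Matrix.mul_assoc, Matrix.mul_nonsing_inv _ h1, Matrix.one_mul,
      Matrix.nonsing_inv_mul_cancel_right _ _ h2]
  have hvec : ∀ b, ∑ a, jac χ (φ u) b a * tension G H φ a u = 0 := by
    intro b
    rw [← hτ b, tension, ← hGinv]
    calc ∑ a, jac χ (φ u) b a * tension G H φ a u
        = ∑ i, ∑ j, (G u)⁻¹ i j * (jac χ (φ u) * covM G H φ j u) b i := by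
          simp only [tension, Matrix.mul_apply, Finset.mul_sum]
          rw [Finset.sum_comm]
          refine Finset.sum_congr rfl fun i _ ↦ ?_
          rw [Finset.sum_comm]
          refine Finset.sum_congr rfl fun j _ ↦ Finset.sum_congr rfl fun a _ ↦ ?_
          ring
      _ = ∑ i, ∑ j, ∑ k, ∑ c, jac ψ u k i * (G u)⁻¹ i j * jac ψ u c j *
            covM G' H' φ' c (ψ u) b k := by
          simp only [hkey]
          simp only [Matrix.mul_apply, Matrix.sum_apply, Matrix.smul_apply, smul_eq_mul,
            Finset.mul_sum, Finset.sum_mul]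
          refine Finset.sum_congr rfl fun i _ ↦ Finset.sum_congr rfl fun j _ ↦
            Finset.sum_congr rfl fun k _ ↦ Finset.sum_congr rfl fun c _ ↦ ?_
          ring
      _ = _ := by
          simp only [Matrix.mul_apply, Matrix.transpose_apply, Finset.sum_mul]
          exact sum_comm_pairs _
  have : (jac χ (φ u)).mulVec (fun a ↦ tension G H φ a u) = 0 := funext hvec
  have := congrArg ((jac χ (φ u))⁻¹.mulVec) this
  rw [Matrix.mulVec_mulVec, Matrix.nonsing_inv_mul _ (Ne.isUnit hχdet), Matrix.one_mulVec,
    Matrix.mulVec_zero] at this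
  exact congrFun this a

end LocalGeometry

/-! ### Curvature, the Ricci identity for df, and the divergence of ∇df. -/

section Bochner

variable {n : ℕ} {G H : E n → Matrix (Fin n) (Fin n) ℝ} {φ : E n → E n} {u : E n}

/-- The curvature matrices of the Levi-Civita connection. -/
def curv (G : E n → Matrix (Fin n) (Fin n) ℝ) (l j : Fin n) (u : E n) :
    Matrix (Fin n) (Fin n) ℝ :=
  dmat l (chrMat G j) u - dmat j (chrMat G l) u + chrMat G l u * chrMat G j u
    - chrMat G j u * chrMat G l u

/-- The Ricci tensor in coordinates. -/
def ricM (G : E n → Matrix (Fin n) (Fin n) ℝ) (u : E n) : Matrix (Fin n) (Fin n) ℝ :=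
  Matrix.of fun j k ↦
    ∑ l, (pderiv l (chr G l j k) u - pderiv j (chr G l l k) u
      + ∑ m, (chr G l l m u * chr G m j k u - chr G l j m u * chr G m l k u))

/-- Ricci is a contraction of the curvature matrices once the lower Christoffel indices are
exchanged. Symmetry is needed on a neighbourhood because the symbols are differentiated. -/
theorem ricM_apply (hG : ∀ᶠ w in 𝓝 u, IsMetricNear G w) (j k : Fin n) :
    ricM G u j k = ∑ l, curv G l j u l k := by
  have hs : ∀ a b c d, pderiv a (chr G b c d) u = pderiv a (chr G b d c) u :=
    fun a b c d ↦ pderiv_congr (hG.mono fun w hw ↦ hw.chr_symm b c d) a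
  have hs0 := hG.self_of_nhds.chr_symm
  simp only [ricM, curv, Matrix.of_apply, Matrix.sub_apply, Matrix.add_apply, Matrix.mul_apply]
  refine Finset.sum_congr rfl fun l _ ↦ ?_
  rw [hs l l j k, hs j l l k, Finset.sum_sub_distrib]
  have h1 : ∀ m, chr G l l m u * chr G m j k u = chrMat G l u l m * chrMat G j u m k :=
    fun m ↦ by rw [hs0 l l m, hs0 m j k]; rfl
  have h2 : ∀ m, chr G l j m u * chr G m l k u = chrMat G j u l m * chrMat G l u m k :=
    fun m ↦ by rw [hs0 l j m, hs0 m l k]; rfl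
  simp only [h1, h2]
  simp only [dmat, chrMat, Matrix.of_apply]
  ring

theorem curv_antisymm (l j : Fin n) : curv G l j u = -curv G j l u := by
  simp only [curv]
  noncomm_ring

theorem dmat_pullChr (hφ : ContDiffAt ℝ ∞ φ u) (hH : IsMetricNear H (φ u)) (l j : Fin n) :
    dmat l (pullChr H φ j) u = ∑ c, (dmat l (jac φ) u c j • chrMat H c (φ u) +
      jac φ u c j • ∑ e, jac φ u e l • dmat e (chrMat H c) (φ u)) := by
  unfold pullChr
  rw [dmat_sum fun c _ ↦ SmoothMat.smul (smoothMat_jac hφ c j) ((hH.smooth_chrMat c).comp hφ)]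
  refine Finset.sum_congr rfl fun c _ ↦ ?_
  rw [dmat_smul (smoothMat_jac hφ c j) ((hH.smooth_chrMat c).comp hφ),
    dmat_comp (hH.smooth_chrMat c) hφ]
  rfl

/-- The curvature of the pulled back connection. -/
theorem pullChr_curv (hφ : ContDiffAt ℝ ∞ φ u) (hH : IsMetricNear H (φ u)) (l j : Fin n) :
    dmat l (pullChr H φ j) u - dmat j (pullChr H φ l) u + pullChr H φ l u * pullChr H φ j u
      - pullChr H φ j u * pullChr H φ l u =
      ∑ e, ∑ c, (jac φ u e l * jac φ u c j) • curv H e c (φ u) := by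
  have h1 : ∀ l j, pullChr H φ l u * pullChr H φ j u =
      ∑ e, ∑ c, (jac φ u e l * jac φ u c j) • (chrMat H e (φ u) * chrMat H c (φ u)) := by
    intro l j
    simp only [pullChr, Finset.sum_mul, Finset.mul_sum, Matrix.smul_mul, Matrix.mul_smul, smul_smul]
    rw [Finset.sum_comm]
    refine Finset.sum_congr rfl fun c _ ↦ Finset.sum_congr rfl fun b _ ↦ ?_
    congr 1
    ring
  have h2 : ∀ l j, dmat l (pullChr H φ j) u = (∑ c, dmat l (jac φ) u c j • chrMat H c (φ u)) +
      ∑ e, ∑ c, (jac φ u e l * jac φ u c j) • dmat e (chrMat H c) (φ u) := by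
    intro l j
    rw [dmat_pullChr hφ hH, Finset.sum_add_distrib]
    congr 1
    simp only [Finset.smul_sum, smul_smul]
    rw [Finset.sum_comm]
    refine Finset.sum_congr rfl fun c _ ↦ Finset.sum_congr rfl fun b _ ↦ ?_
    congr 1
    ring
  have hswap : ∀ F : Fin n → Fin n → Matrix (Fin n) (Fin n) ℝ,
      ∑ e, ∑ c, (jac φ u e j * jac φ u c l) • F e c =
        ∑ e, ∑ c, (jac φ u e l * jac φ u c j) • F c e := by
    intro F
    rw [Finset.sum_comm]
    refine Finset.sum_congr rfl fun c _ ↦ Finset.sum_congr rfl fun b _ ↦ ?_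
    congr 1
    ring
  -- Second derivatives of φ are symmetric in l and j, so they leave no trace in the curvature.
  have h3 : ∑ c, dmat l (jac φ) u c j • chrMat H c (φ u) =
      ∑ c, dmat j (jac φ) u c l • chrMat H c (φ u) :=
    Finset.sum_congr rfl fun c _ ↦ by rw [dmat_jac_symm hφ l j c]
  rw [h1 l j, h1 j l, h2 l j, h2 j l, hswap, hswap, h3]
  simp only [curv, smul_add, smul_sub, Finset.sum_add_distrib, Finset.sum_sub_distrib]
  abel

/-- The covariant derivative of `covM G H φ j` in the direction `l`, with `j` fixed. -/
def covD (G H : E n → Matrix (Fin n) (Fin n) ℝ) (φ : E n → E n) (l j : Fin n) (u : E n) :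
    Matrix (Fin n) (Fin n) ℝ :=
  dmat l (covM G H φ j) u - covM G H φ j u * chrMat G l u + pullChr H φ l u * covM G H φ j u

/-- Ricci identity: dφ is a section of Hom(TM, φ^*TN), and the curvature of that bundle is the
target curvature on the left minus the source curvature on the right. The connection term on the
label j that `covD` omits is symmetric in l and j, so its absence is harmless. -/
theorem covD_comm (hG : IsMetricNear G u) (hφ : ContDiffAt ℝ ∞ φ u)
    (hH : IsMetricNear H (φ u)) (l j : Fin n) :
    covD G H φ l j u - covD G H φ j l u =
      (∑ e, ∑ c, (jac φ u e l * jac φ u c j) • curv H e c (φ u)) * jac φ u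
        - jac φ u * curv G l j u := by
  have hJ := smoothMat_jac hφ
  have h : ∀ l j, dmat l (covM G H φ j) u = dmat l (dmat j (jac φ)) u
      - (dmat l (jac φ) u * chrMat G j u + jac φ u * dmat l (chrMat G j) u)
      + (dmat l (pullChr H φ j) u * jac φ u + pullChr H φ j u * dmat l (jac φ) u) := by
    intro l j
    unfold covM
    rw [dmat_add ((hJ.dmat j).sub (hJ.mul (hG.smooth_chrMat j)))
        ((smoothMat_pullChr hφ hH j).mul hJ),
      dmat_sub (hJ.dmat j) (hJ.mul (hG.smooth_chrMat j)), dmat_mul hJ (hG.smooth_chrMat j),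
      dmat_mul (smoothMat_pullChr hφ hH j) hJ]
  rw [← pullChr_curv hφ hH]
  simp only [covD, h, curv, dmat_comm hJ l j, covM]
  noncomm_ring

/-- The product rule with d(J⁻¹) = -J⁻¹ dJ J⁻¹. Replacing partial by covariant derivatives is free,
since the connection matrices cancel under the trace. -/
theorem pderiv_trace_inv_mul_covM (hG : IsMetricNear G u) (hφ : ContDiffAt ℝ ∞ φ u)
    (hH : IsMetricNear H (φ u)) (hdet : (jac φ u).det ≠ 0) (l j : Fin n) :
    pderiv l (fun w ↦ ((jac φ w)⁻¹ * covM G H φ j w).trace) u =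
      ((jac φ u)⁻¹ * covD G H φ l j u).trace
        - ((jac φ u)⁻¹ * covM G H φ l u * (jac φ u)⁻¹ * covM G H φ j u).trace := by
  have hJ := smoothMat_jac hφ
  have hA := smoothMat_covM hG hφ hH
  rw [pderiv_trace ((hJ.inv hdet).mul (hA j)), dmat_mul (hJ.inv hdet) (hA j), dmat_inv hJ hdet]
  have hd : dmat l (jac φ) u = covM G H φ l u + jac φ u * chrMat G l u
      - pullChr H φ l u * jac φ u := by
    simp only [covM]; abel
  have hdA : dmat l (covM G H φ j) u = covD G H φ l j u + covM G H φ j u * chrMat G l u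
      - pullChr H φ l u * covM G H φ j u := by
    simp only [covD]; abel
  have hinv := Ne.isUnit hdet
  have e : (jac φ u)⁻¹ * (covM G H φ l u + jac φ u * chrMat G l u
      - pullChr H φ l u * jac φ u) * (jac φ u)⁻¹ =
      (jac φ u)⁻¹ * covM G H φ l u * (jac φ u)⁻¹ + chrMat G l u * (jac φ u)⁻¹
        - (jac φ u)⁻¹ * pullChr H φ l u := by
    rw [Matrix.mul_sub, Matrix.mul_add, Matrix.nonsing_inv_mul_cancel_left _ _ hinv,
      Matrix.sub_mul, Matrix.add_mul, ← Matrix.mul_assoc,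
      Matrix.mul_nonsing_inv_cancel_right _ _ hinv]
  have t : (chrMat G l u * ((jac φ u)⁻¹ * covM G H φ j u)).trace =
      ((jac φ u)⁻¹ * (covM G H φ j u * chrMat G l u)).trace := by
    rw [Matrix.trace_mul_comm, Matrix.mul_assoc]
  rw [hd, e, hdA]
  simp only [Matrix.neg_mul, Matrix.sub_mul, Matrix.add_mul, Matrix.mul_sub, Matrix.mul_add,
    Matrix.trace_add, Matrix.trace_sub, Matrix.trace_neg, Matrix.mul_assoc] at t ⊢
  rw [t]
  ring

/-- The divergence of the second fundamental form of a harmonic map. -/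
theorem sum_inv_mul_covD (hG : ∀ᶠ w in 𝓝 u, IsMetricNear G w)
    (hφ : ∀ᶠ w in 𝓝 u, ContDiffAt ℝ ∞ φ w) (hH : ∀ᶠ w in 𝓝 u, IsMetricNear H (φ w))
    (hτ : ∀ᶠ w in 𝓝 u, ∀ a, tension G H φ a w = 0) (a i : Fin n) :
    ∑ l, ∑ j, (G u)⁻¹ l j * covD G H φ l j u a i =
      ∑ l, ∑ j, (G u)⁻¹ l j * (covD G H φ l i u - covD G H φ i l u) a j
        + ∑ l, ∑ j, (G u)⁻¹ l j * ∑ k, covM G H φ k u a i * chrMat G l u k j := by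
  have hG0 := hG.self_of_nhds
  have hφ0 := hφ.self_of_nhds
  have hH0 := hH.self_of_nhds
  have hAs := covM_symm hG0 hφ0 hH0
  have hA := smoothMat_covM hG0 hφ0 hH0
  have hdAs : ∀ l j, dmat l (covM G H φ j) u a i = dmat l (covM G H φ i) u a j := fun l j ↦
    pderiv_congr (hG.mp (hφ.mp (hH.mono fun w h1 h2 h3 ↦ covM_symm h3 h2 h1 i j a))) l
  have hΓs : ∀ l k, chrMat G l u k i = chrMat G i u k l := fun l k ↦ hG0.chr_symm k i l
  have hτ0 : ∀ b, ∑ l, ∑ j, (G u)⁻¹ l j * covM G H φ l u b j = 0 := by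
    intro b
    rw [← hτ.self_of_nhds b, tension]
    refine Finset.sum_congr rfl fun l _ ↦ Finset.sum_congr rfl fun j _ ↦ ?_
    rw [hAs]
  -- The tension equation holds near u, so it may be differentiated in direction i.
  have hτ1 : ∑ l, ∑ j, (dmat i (fun w ↦ (G w)⁻¹) u l j * covM G H φ l u a j +
      (G u)⁻¹ l j * dmat i (covM G H φ l) u a j) = 0 := by
    have h0 : pderiv i (fun w ↦ ∑ l, ∑ j, (G w)⁻¹ l j * covM G H φ l w a j) u = 0 := by
      rw [pderiv_congr (ψ := fun _ ↦ 0), pderiv_const]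
      filter_upwards [hG, hφ, hH, hτ] with w h1 h2 h3 h4
      rw [← h4 a, tension]
      refine Finset.sum_congr rfl fun l _ ↦ Finset.sum_congr rfl fun j _ ↦ ?_
      rw [covM_symm h1 h2 h3]
    have hd : ∀ l j, DifferentiableAt ℝ (fun w ↦ (G w)⁻¹ l j * covM G H φ l w a j) u :=
      fun l j ↦ ((hG0.smooth.inv hG0.det_ne).differentiableAt l j).mul
        ((hA l).differentiableAt a j)
    rw [← h0, pderiv_sum (φ := fun l w ↦ ∑ j, (G w)⁻¹ l j * covM G H φ l w a j)
      fun l _ ↦ DifferentiableAt.fun_sum fun j _ ↦ hd l j]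
    refine Finset.sum_congr rfl fun l _ ↦ ?_
    rw [pderiv_sum (φ := fun j w ↦ (G w)⁻¹ l j * covM G H φ l w a j) fun j _ ↦ hd l j]
    exact Finset.sum_congr rfl fun j _ ↦
      (pderiv_mul ((hG0.smooth.inv hG0.det_ne).differentiableAt l j)
        ((hA l).differentiableAt a j) i).symm
  have hp0 : ∑ l, ∑ j, (G u)⁻¹ l j * (pullChr H φ i u * covM G H φ l u) a j = 0 := by
    simp only [Matrix.mul_apply, Finset.mul_sum]
    calc ∑ l, ∑ j, ∑ b, (G u)⁻¹ l j * (pullChr H φ i u a b * covM G H φ l u b j)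
        = ∑ b, ∑ l, ∑ j, (G u)⁻¹ l j * (pullChr H φ i u a b * covM G H φ l u b j) := by
          exact (Finset.sum_congr rfl fun l _ ↦ Finset.sum_comm).trans Finset.sum_comm
      _ = ∑ b, pullChr H φ i u a b * ∑ l, ∑ j, (G u)⁻¹ l j * covM G H φ l u b j := by
          simp only [Finset.mul_sum]
          refine Finset.sum_congr rfl fun b _ ↦ Finset.sum_congr rfl fun l _ ↦
            Finset.sum_congr rfl fun j _ ↦ ?_
          ring
      _ = 0 := by simp [hτ0]
  -- The inverse metric is parallel, so its derivative turns into Christoffel terms, which cancel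
  -- those produced in `hpt`.
  have hdg : ∑ l, ∑ j, dmat i (fun w ↦ (G w)⁻¹) u l j * covM G H φ l u a j =
      -(∑ l, ∑ j, (G u)⁻¹ l j * (covM G H φ l u * chrMat G i u) a j)
        - ∑ l, ∑ j, (G u)⁻¹ l j * (covM G H φ j u * chrMat G l u) a i := by
    have e1 : ∑ l, ∑ j, (G u)⁻¹ l j * (covM G H φ l u * chrMat G i u) a j =
        ∑ l, ∑ j, ((G u)⁻¹ * (chrMat G i u).transpose) l j * covM G H φ l u a j := by
      simp only [Matrix.mul_apply, Finset.mul_sum, Finset.sum_mul, Matrix.transpose_apply]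
      refine Finset.sum_congr rfl fun l _ ↦ ?_
      rw [Finset.sum_comm]
      exact Finset.sum_congr rfl fun j _ ↦ Finset.sum_congr rfl fun k _ ↦ by ring
    have e2 : ∑ l, ∑ j, (G u)⁻¹ l j * (covM G H φ j u * chrMat G l u) a i =
        ∑ l, ∑ j, (chrMat G i u * (G u)⁻¹) l j * covM G H φ l u a j := by
      simp only [Matrix.mul_apply, Finset.mul_sum, Finset.sum_mul, hΓs]
      calc ∑ l, ∑ j, ∑ k, (G u)⁻¹ l j * (covM G H φ j u a k * chrMat G i u k l)
          = ∑ l, ∑ k, ∑ j, (G u)⁻¹ l j * (covM G H φ j u a k * chrMat G i u k l) :=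
            Finset.sum_congr rfl fun l _ ↦ Finset.sum_comm
        _ = ∑ k, ∑ j, ∑ l, (G u)⁻¹ l j * (covM G H φ j u a k * chrMat G i u k l) :=
            Finset.sum_comm.trans (Finset.sum_congr rfl fun k _ ↦ Finset.sum_comm)
        _ = _ := Finset.sum_congr rfl fun k _ ↦ Finset.sum_congr rfl fun j _ ↦
            Finset.sum_congr rfl fun l _ ↦ by rw [hAs k j a]; ring
    rw [e1, e2, hG0.dmat_inv_eq, ← Finset.sum_neg_distrib, ← Finset.sum_sub_distrib]
    refine Finset.sum_congr rfl fun l _ ↦ ?_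
    rw [← Finset.sum_neg_distrib, ← Finset.sum_sub_distrib]
    refine Finset.sum_congr rfl fun j _ ↦ ?_
    rw [Matrix.neg_apply, Matrix.add_apply]
    ring
  -- Exchange j and i by symmetry of ∇dφ, then the derivatives l and i at the cost of curvature.
  -- What remains is the i-derivative of the tension field, together with Christoffel terms because
  -- `covD` ignores its label.
  have hpt : ∀ l j, covD G H φ l j u a i = (covD G H φ l i u - covD G H φ i l u) a j
      + ∑ k, covM G H φ k u a i * chrMat G l u k j - (covM G H φ j u * chrMat G l u) a i
      + (dmat i (covM G H φ l) u a j - (covM G H φ l u * chrMat G i u) a j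
        + (pullChr H φ i u * covM G H φ l u) a j) := by
    intro l j
    have e1 : (pullChr H φ l u * covM G H φ j u) a i = (pullChr H φ l u * covM G H φ i u) a j := by
      simp only [Matrix.mul_apply, hAs i j]
    have e2 : (covM G H φ i u * chrMat G l u) a j =
        ∑ k, covM G H φ k u a i * chrMat G l u k j := by
      simp only [Matrix.mul_apply, hAs i]
    rw [← e2]
    simp only [covD, Matrix.add_apply, Matrix.sub_apply, hdAs l j, e1]
    ring
  simp only [Finset.sum_add_distrib] at hτ1
  simp only [hpt, mul_add, mul_sub, Finset.sum_add_distrib, Finset.sum_sub_distrib, hp0]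
  linarith

end Bochner

/-! ### The Bochner formula and the derivative of log V. -/

section MaximumPrinciple

variable {n : ℕ} {G H : E n → Matrix (Fin n) (Fin n) ℝ} {φ : E n → E n} {u : E n}

/-- The Bochner formula for the logarithm of the Jacobian of a harmonic map, at a critical point. -/
theorem bochner_formula (hG : ∀ᶠ w in 𝓝 u, IsMetricNear G w)
    (hφ : ∀ᶠ w in 𝓝 u, ContDiffAt ℝ ∞ φ w) (hH : ∀ᶠ w in 𝓝 (φ u), IsMetricNear H w)
    (hdet : (jac φ u).det ≠ 0) (hτ : ∀ᶠ w in 𝓝 u, ∀ a, tension G H φ a w = 0)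
    (hcrit : ∀ k, ((jac φ u)⁻¹ * covM G H φ k u).trace = 0) :
    ∑ l, ∑ j, (G u)⁻¹ l j * pderiv l (fun w ↦ ((jac φ w)⁻¹ * covM G H φ j w).trace) u =
      ∑ l, ∑ j, (G u)⁻¹ l j * ricM G u l j
        - ∑ l, ∑ j, (G u)⁻¹ l j * ((jac φ u).transpose * ricM H (φ u) * jac φ u) l j
        - ∑ l, ∑ j, (G u)⁻¹ l j *
          ((jac φ u)⁻¹ * covM G H φ l u * (jac φ u)⁻¹ * covM G H φ j u).trace := by
  have hG0 := hG.self_of_nhds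
  have hφ0 := hφ.self_of_nhds
  have hH0 := hH.self_of_nhds
  have hHφ : ∀ᶠ w in 𝓝 u, IsMetricNear H (φ w) := hφ0.continuousAt.eventually hH
  have hunit := Ne.isUnit hdet
  simp only [pderiv_trace_inv_mul_covM hG0 hφ0 hH0 hdet, mul_sub, Finset.sum_sub_distrib]
  congr 1
  set J := jac φ u with hJ
  -- In the Ricci identity J⁻¹ cancels against J, on the source side directly and on the target side
  -- through the contracted index, leaving the two Ricci tensors.
  have hcurv : ∀ l j, ∑ i, (J⁻¹ * (covD G H φ l i u - covD G H φ i l u)) i j =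
      ricM G u l j - (J.transpose * ricM H (φ u) * J) l j := by
    intro l j
    have h1 : ∑ i, (J⁻¹ * (J * curv G l i u)) i j = -ricM G u l j := by
      rw [ricM_apply hG, ← Finset.sum_neg_distrib]
      refine Finset.sum_congr rfl fun i _ ↦ ?_
      rw [Matrix.nonsing_inv_mul_cancel_left _ _ hunit, curv_antisymm]
      rfl
    have h2 : ∑ i, (J⁻¹ * ((∑ e, ∑ c, (J e l * J c i) • curv H e c (φ u)) * J)) i j =
        -(J.transpose * ricM H (φ u) * J) l j := by
      calc ∑ i, (J⁻¹ * ((∑ e, ∑ c, (J e l * J c i) • curv H e c (φ u)) * J)) i j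
          = ∑ i, ∑ e, ∑ c, J e l * (J c i * (J⁻¹ * (curv H e c (φ u) * J)) i j) := by
            refine Finset.sum_congr rfl fun i _ ↦ ?_
            simp only [Finset.sum_mul, Finset.mul_sum, Matrix.smul_mul, Matrix.mul_smul,
              Matrix.sum_apply, Matrix.smul_apply, smul_eq_mul, mul_assoc]
        _ = ∑ e, ∑ c, J e l * (J * (J⁻¹ * (curv H e c (φ u) * J))) c j := by
            rw [Finset.sum_comm]
            refine Finset.sum_congr rfl fun e _ ↦ ?_
            rw [Finset.sum_comm]
            refine Finset.sum_congr rfl fun c _ ↦ ?_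
            rw [← Finset.mul_sum, Matrix.mul_apply]
        _ = ∑ e, ∑ c, ∑ b, J e l * (curv H e c (φ u) c b * J b j) := by
            refine Finset.sum_congr rfl fun e _ ↦ Finset.sum_congr rfl fun c _ ↦ ?_
            rw [Matrix.mul_nonsing_inv_cancel_left _ _ hunit, Matrix.mul_apply, Finset.mul_sum]
        _ = ∑ e, ∑ b, J e l * ((-ricM H (φ u) e b) * J b j) := by
            refine Finset.sum_congr rfl fun e _ ↦ ?_
            rw [Finset.sum_comm]
            refine Finset.sum_congr rfl fun b _ ↦ ?_
            rw [← Finset.mul_sum, ← Finset.sum_mul, ricM_apply hH, ← Finset.sum_neg_distrib]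
            congr 2
            refine Finset.sum_congr rfl fun c _ ↦ ?_
            rw [curv_antisymm]
            rfl
        _ = _ := by
            rw [Matrix.mul_assoc, Matrix.mul_apply, ← Finset.sum_neg_distrib]
            refine Finset.sum_congr rfl fun e _ ↦ ?_
            rw [Matrix.mul_apply, Finset.mul_sum, ← Finset.sum_neg_distrib]
            refine Finset.sum_congr rfl fun b _ ↦ ?_
            rw [Matrix.transpose_apply]
            ring
    simp only [covD_comm hG0 hφ0 hH0, Matrix.mul_sub, Matrix.sub_apply, Finset.sum_sub_distrib,
      ← hJ, h1, h2]
    ring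
  have hpull : ∀ F : Fin n → Fin n → Fin n → Fin n → ℝ,
      ∑ l, ∑ j, (G u)⁻¹ l j * ∑ i, ∑ a, J⁻¹ i a * F l j a i =
        ∑ i, ∑ a, J⁻¹ i a * ∑ l, ∑ j, (G u)⁻¹ l j * F l j a i := by
    intro F
    simp only [Finset.mul_sum]
    rw [sum_comm_pairs]
    refine Finset.sum_congr rfl fun i _ ↦ Finset.sum_congr rfl fun a _ ↦ ?_
    rw [Finset.sum_comm]
    exact Finset.sum_congr rfl fun l _ ↦ Finset.sum_congr rfl fun j _ ↦ by ring
  have htr : ∀ l j, (J⁻¹ * covD G H φ l j u).trace =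
      ∑ i, ∑ a, J⁻¹ i a * covD G H φ l j u a i := fun l j ↦ by
    simp only [Matrix.trace, Matrix.diag, Matrix.mul_apply]
  simp only [htr]
  rw [hpull fun l j a i ↦ covD G H φ l j u a i]
  simp only [sum_inv_mul_covD hG hφ hHφ hτ, mul_add, Finset.sum_add_distrib]
  rw [← hpull fun l j a i ↦ (covD G H φ l i u - covD G H φ i l u) a j,
    ← hpull fun l j a i ↦ ∑ k, covM G H φ k u a i * chrMat G l u k j]
  -- These are the first-order terms Γ^k_{lj} ∂_k W by which the Laplacian differs from the
  -- contracted coordinate Hessian; they vanish at a critical point.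
  have hz : ∀ l j, ∑ i, ∑ a, J⁻¹ i a * ∑ k, covM G H φ k u a i * chrMat G l u k j = 0 := by
    intro l j
    calc ∑ i, ∑ a, J⁻¹ i a * ∑ k, covM G H φ k u a i * chrMat G l u k j
        = ∑ i, ∑ k, (J⁻¹ * covM G H φ k u) i i * chrMat G l u k j := by
          refine Finset.sum_congr rfl fun i _ ↦ ?_
          simp only [Matrix.mul_apply, Finset.mul_sum, Finset.sum_mul]
          rw [Finset.sum_comm]
          exact Finset.sum_congr rfl fun k _ ↦ Finset.sum_congr rfl fun a _ ↦ by ring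
      _ = ∑ k, (J⁻¹ * covM G H φ k u).trace * chrMat G l u k j := by
          rw [Finset.sum_comm]
          simp only [Matrix.trace, Matrix.diag, Finset.sum_mul]
      _ = 0 := by simp [hcrit]
  have hx : ∀ l j, ∑ i, ∑ a, J⁻¹ i a * (covD G H φ l i u - covD G H φ i l u) a j =
      ricM G u l j - (J.transpose * ricM H (φ u) * J) l j := fun l j ↦ by
    rw [← hcurv]
    simp only [Matrix.mul_apply]
  simp only [hz, hx, mul_zero, Finset.sum_const_zero, add_zero, mul_sub, Finset.sum_sub_distrib]

/-- The logarithmic derivative of the squared Jacobian. -/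
theorem pderiv_log_density (hG : IsMetricNear G u) (hφ : ContDiffAt ℝ ∞ φ u)
    (hH : IsMetricNear H (φ u)) (hdet : (jac φ u).det ≠ 0) (j : Fin n) :
    pderiv j (fun w ↦ Real.log ((jac φ w).transpose * H (φ w) * jac φ w).det
      - Real.log (G w).det) u = 2 * ((jac φ u)⁻¹ * covM G H φ j u).trace := by
  have hJ := smoothMat_jac hφ
  have hHφ := hH.smooth.comp hφ
  have hF : SmoothMat (fun w ↦ (jac φ w).transpose * H (φ w) * jac φ w) u :=
    (hJ.transpose.mul hHφ).mul hJ
  have hFdet : ((jac φ u).transpose * H (φ u) * jac φ u).det ≠ 0 := by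
    simp [hdet, hH.det_ne]
  have hs : (H (φ u)).transpose = H (φ u) := hH.symm.self_of_nhds
  rw [pderiv_sub ((hF.det.log hFdet).differentiableAt (by simp))
    ((hG.smooth.det.log hG.det_ne).differentiableAt (by simp)), pderiv_log_det hF hFdet,
    pderiv_log_det hG.smooth hG.det_ne, hG.trace_inv_mul_dmat,
    dmat_mul (hJ.transpose.mul hHφ) hJ, dmat_mul hJ.transpose hHφ, dmat_transpose]
  have hdH := hH.dmat_comp_eq hφ j
  have hd : dmat j (jac φ) u = covM G H φ j u + jac φ u * chrMat G j u
      - pullChr H φ j u * jac φ u := by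
    simp only [covM]; abel
  set J := jac φ u
  set P := H (φ u)
  set A := covM G H φ j u
  set Γ := chrMat G j u
  set F := J.transpose * P * J with hFdef
  have hFu := Ne.isUnit hFdet
  have hFs : F.transpose = F := by
    simp only [hFdef, Matrix.transpose_mul, Matrix.transpose_transpose, hs, Matrix.mul_assoc]
  -- The target connection cancels by compatibility; the source connection survives and is removed
  -- later by the derivative of log det G.
  have e : ((dmat j (jac φ) u).transpose * P + J.transpose * dmat j (fun w ↦ H (φ w)) u) * J
      + J.transpose * P * dmat j (jac φ) u =
      (J.transpose * P * A).transpose + J.transpose * P * A + Γ.transpose * F + F * Γ := by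
    rw [hdH, hd]
    simp only [hFdef, Matrix.transpose_mul, Matrix.transpose_transpose, Matrix.transpose_add,
      Matrix.transpose_sub, hs]
    noncomm_ring
  have hA : F⁻¹ * (J.transpose * P * A) = J⁻¹ * A := by
    have : J.transpose * P * A = F * (J⁻¹ * A) := by
      rw [hFdef, Matrix.mul_assoc _ J, Matrix.mul_nonsing_inv_cancel_left _ _ (Ne.isUnit hdet)]
    rw [this, Matrix.nonsing_inv_mul_cancel_left _ _ hFu]
  have hA' : (F⁻¹ * (J.transpose * P * A).transpose).trace = (J⁻¹ * A).trace := by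
    rw [← hA, ← Matrix.trace_transpose (F⁻¹ * (J.transpose * P * A)),
      Matrix.transpose_mul F⁻¹, Matrix.transpose_nonsing_inv, hFs, Matrix.trace_mul_comm]
  have hΓ : (F⁻¹ * (Γ.transpose * F)).trace = Γ.trace := by
    rw [Matrix.trace_mul_comm, Matrix.mul_nonsing_inv_cancel_right _ _ hFu,
      Matrix.trace_transpose]
  rw [e]
  simp only [Matrix.mul_add, Matrix.trace_add, hA, hA', hΓ,
    Matrix.nonsing_inv_mul_cancel_left _ _ hFu]
  ring

end MaximumPrinciple

/-! ### The second derivative test for the traced Hessian. -/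

section SecondDerivativeTest

variable {n : ℕ} {u : E n}

/-- A positive second derivative would make t a local minimum as well, so h would be locally
constant with second derivative 0. -/
theorem deriv_deriv_nonpos_of_isLocalMax {h : ℝ → ℝ} {t : ℝ} (hc : ContinuousAt h t)
    (hmax : IsLocalMax h t) : deriv (deriv h) t ≤ 0 := by
  by_contra! hpos
  have hmin := isLocalMin_of_deriv_deriv_pos hpos hmax.deriv_eq_zero hc
  have heq : h =ᶠ[𝓝 t] fun _ ↦ h t := by
    filter_upwards [hmax, hmin] with s h1 h2 using le_antisymm h1 h2
  have : deriv (deriv h) t = 0 := by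
    rw [heq.deriv.deriv_eq]
    simp
  linarith

theorem fderiv_fderiv_nonpos_of_isLocalMax {W : E n → ℝ} (hW : ContDiffAt ℝ ∞ W u)
    (hmax : IsLocalMax W u) (v : E n) : fderiv ℝ (fderiv ℝ W) u v v ≤ 0 := by
  have hline : ∀ t : ℝ, HasDerivAt (fun t : ℝ ↦ u + t • v) v t := fun t ↦ by
    simpa using ((hasDerivAt_id t).smul_const v).const_add u
  have h0 : u + (0 : ℝ) • v = u := by simp
  have hcont : Filter.Tendsto (fun t : ℝ ↦ u + t • v) (𝓝 0) (𝓝 u) := by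
    simpa using (hline 0).continuousAt.tendsto
  have hd : ∀ᶠ w in 𝓝 u, DifferentiableAt ℝ W w :=
    ((hW.of_le (m := 1) (by simp)).eventually (by simp)).mono fun w hw ↦
      hw.differentiableAt (by simp)
  have h1 : deriv (fun t : ℝ ↦ W (u + t • v)) =ᶠ[𝓝 0] fun t ↦ fderiv ℝ W (u + t • v) v := by
    filter_upwards [hcont.eventually hd] with t ht
    exact (ht.hasFDerivAt.comp_hasDerivAt t (hline t)).deriv
  have hW2 : DifferentiableAt ℝ (fderiv ℝ W) u :=
    (hW.fderiv_right (m := ∞) (by simp)).differentiableAt (by simp)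
  have h2 : HasDerivAt (fun t : ℝ ↦ fderiv ℝ W (u + t • v) v)
      (fderiv ℝ (fderiv ℝ W) u v v) 0 := by
    have h3 : HasDerivAt (fun t : ℝ ↦ fderiv ℝ W (u + t • v)) (fderiv ℝ (fderiv ℝ W) u v) 0 :=
      HasFDerivAt.comp_hasDerivAt_of_eq (0 : ℝ) hW2.hasFDerivAt (hline 0) h0.symm
    simpa using h3.clm_apply (hasDerivAt_const (0 : ℝ) v)
  rw [← h2.deriv, ← h1.deriv_eq]
  refine deriv_deriv_nonpos_of_isLocalMax ?_ ?_
  · exact ContinuousAt.comp_of_eq hW.continuousAt (hline 0).continuousAt h0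
  · have := hcont.eventually hmax
    filter_upwards [this] with t ht
    simpa using ht

/-- At a local maximum, the trace of the Hessian with respect to a positive semidefinite form is
nonpositive. -/
theorem sum_mul_pderiv_pderiv_nonpos {W : E n → ℝ} (hW : ContDiffAt ℝ ∞ W u)
    (hmax : IsLocalMax W u) {P : Matrix (Fin n) (Fin n) ℝ} (hP : P.PosSemidef) :
    ∑ l, ∑ j, P l j * pderiv l (pderiv j W) u ≤ 0 := by
  -- Decompose the form into rank-one forms v vᵀ; each contributes the Hessian evaluated on (v, v).
  obtain ⟨m, v, rfl⟩ := Matrix.posSemidef_iff_eq_sum_vecMulVec.1 hP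
  have hd : DifferentiableAt ℝ (fderiv ℝ W) u :=
    (hW.fderiv_right (m := ∞) (by simp)).differentiableAt (by simp)
  have key : ∀ i j : Fin n, pderiv i (pderiv j W) u =
      fderiv ℝ (fderiv ℝ W) u (EuclideanSpace.single i 1) (EuclideanSpace.single j 1) :=
    fun i j ↦ pderiv_pderiv_eq hd i j
  have hexp : ∀ k, fderiv ℝ (fderiv ℝ W) u (∑ l, v k l • EuclideanSpace.single l (1 : ℝ))
      (∑ j, v k j • EuclideanSpace.single j (1 : ℝ)) =
      ∑ l, ∑ j, v k l * v k j * pderiv l (pderiv j W) u := by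
    intro k
    simp only [map_sum, map_smul, sum_apply, smul_apply, smul_eq_mul, key,
      Finset.mul_sum]
    rw [Finset.sum_comm]
    exact Finset.sum_congr rfl fun _ _ ↦ Finset.sum_congr rfl fun _ _ ↦ by ring
  calc ∑ l, ∑ j, (∑ k, Matrix.vecMulVec (v k) (star (v k))) l j * pderiv l (pderiv j W) u
      = ∑ k, ∑ l, ∑ j, v k l * v k j * pderiv l (pderiv j W) u := by
        simp only [Matrix.sum_apply, Matrix.vecMulVec_apply, Finset.sum_mul, star_trivial]
        exact (Finset.sum_congr rfl fun l _ ↦ Finset.sum_comm).trans Finset.sum_comm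
    _ ≤ 0 := Finset.sum_nonpos fun k _ ↦ by
        rw [← hexp k]
        exact fderiv_fderiv_nonpos_of_isLocalMax hW hmax _

/-- The curvature inequality at a local maximum of the Jacobian of a harmonic map. -/
theorem curvature_inequality_of_isLocalMax {G H : E n → Matrix (Fin n) (Fin n) ℝ} {φ : E n → E n}
    (hG : ∀ᶠ w in 𝓝 u, IsMetricNear G w) (hGpos : (G u).PosDef)
    (hφ : ∀ᶠ w in 𝓝 u, ContDiffAt ℝ ∞ φ w) (hH : ∀ᶠ w in 𝓝 (φ u), IsMetricNear H w)
    (hdet : (jac φ u).det ≠ 0) (hτ : ∀ᶠ w in 𝓝 u, ∀ a, tension G H φ a w = 0)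
    (hmax : IsLocalMax (fun w ↦ Real.log ((jac φ w).transpose * H (φ w) * jac φ w).det
      - Real.log (G w).det) u) :
    ∑ l, ∑ j, (G u)⁻¹ l j * ricM G u l j
        - ∑ l, ∑ j, (G u)⁻¹ l j * ((jac φ u).transpose * ricM H (φ u) * jac φ u) l j
        - ∑ l, ∑ j, (G u)⁻¹ l j *
          ((jac φ u)⁻¹ * covM G H φ l u * (jac φ u)⁻¹ * covM G H φ j u).trace ≤ 0 := by
  have hG0 := hG.self_of_nhds
  have hφ0 := hφ.self_of_nhds
  have hH0 := hH.self_of_nhds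
  have hJ := smoothMat_jac hφ0
  set W : E n → ℝ := fun w ↦ Real.log ((jac φ w).transpose * H (φ w) * jac φ w).det
      - Real.log (G w).det with hWdef
  have hW : ContDiffAt ℝ ∞ W u := by
    refine ContDiffAt.sub (ContDiffAt.log ?_ ?_) (hG0.smooth.det.log hG0.det_ne)
    · exact ((hJ.transpose.mul (hH0.smooth.comp hφ0)).mul hJ).det
    · simp [hdet, hH0.det_ne]
  -- The formula holds near u, not only at u, so it can be differentiated again.
  have hdW : ∀ j, pderiv j W =ᶠ[𝓝 u]
      fun w ↦ 2 * ((jac φ w)⁻¹ * covM G H φ j w).trace := by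
    intro j
    filter_upwards [hG, hφ, hφ0.continuousAt.eventually hH,
      hJ.det.continuousAt.eventually_ne hdet] with w h1 h2 h3 h4
    exact pderiv_log_density h1 h2 h3 h4 j
  have hcrit : ∀ k, ((jac φ u)⁻¹ * covM G H φ k u).trace = 0 := by
    intro k
    have h1 : pderiv k W u = 0 := by
      simp [pderiv, hmax.fderiv_eq_zero]
    have h2 := (hdW k).self_of_nhds
    simp only [h1] at h2
    linarith
  rw [← bochner_formula hG hφ hH hdet hτ hcrit]
  have hnonpos := sum_mul_pderiv_pderiv_nonpos hW hmax hGpos.inv.posSemidef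
  have hdd : ∀ l j, pderiv l (pderiv j W) u =
      2 * pderiv l (fun w ↦ ((jac φ w)⁻¹ * covM G H φ j w).trace) u := by
    intro l j
    have hd : DifferentiableAt ℝ (fun w ↦ ((jac φ w)⁻¹ * covM G H φ j w).trace) u := by
      have := (hJ.inv hdet).mul (smoothMat_covM hG0 hφ0 hH0 j)
      exact DifferentiableAt.fun_sum fun a _ ↦ this.differentiableAt a a
    rw [pderiv_congr (hdW j), pderiv_mul (differentiableAt_const _) hd, pderiv_const]
    ring
  have hsum : ∑ l, ∑ j, (G u)⁻¹ l j * pderiv l (pderiv j W) u = 2 * ∑ l, ∑ j, (G u)⁻¹ l j *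
      pderiv l (fun w ↦ ((jac φ w)⁻¹ * covM G H φ j w).trace) u := by
    simp only [hdd, Finset.mul_sum]
    exact Finset.sum_congr rfl fun l _ ↦ Finset.sum_congr rfl fun j _ ↦ by ring
  linarith

end SecondDerivativeTest

/-! ### Rigidity of trace and determinant for ordered positive forms. -/

section LinearAlgebra

open Matrix

variable {n : ℕ} {G Q S : Matrix (Fin n) (Fin n) ℝ}

/-- In an eigenbasis this is 1 + Σλ_i ≤ ∏(1 + λ_i) for λ_i ≥ 0. -/
theorem one_add_trace_le_det_one_add (hS : S.PosSemidef) : 1 + S.trace ≤ (1 + S).det := by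
  have hdet : (1 + S).det = ∏ i, (1 + hS.1.eigenvalues i) := by
    set U : Matrix (Fin n) (Fin n) ℝ := (hS.1.eigenvectorUnitary : Matrix (Fin n) (Fin n) ℝ)
    have hU : U * star U = 1 := Unitary.coe_mul_star_self _
    have hS' : S = U * diagonal hS.1.eigenvalues * star U := by
      conv_lhs => rw [hS.1.spectral_theorem, Unitary.conjStarAlgAut_apply]
      rfl
    have h1 : 1 + S = U * diagonal (fun i ↦ 1 + hS.1.eigenvalues i) * star U := by
      have : diagonal (fun i ↦ 1 + hS.1.eigenvalues i) = 1 + diagonal hS.1.eigenvalues := by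
        rw [← diagonal_one, diagonal_add]
      rw [this, Matrix.mul_add, Matrix.mul_one, Matrix.add_mul, hU, ← hS']
    rw [h1, det_mul, det_mul, mul_right_comm, ← det_mul, hU, det_one, one_mul, det_diagonal]
  rw [hdet, hS.1.trace_eq_sum_eigenvalues]
  simp only [RCLike.ofReal_real_eq_id, id]
  have : ∀ s : Finset (Fin n), 1 + ∑ i ∈ s, hS.1.eigenvalues i ≤
      ∏ i ∈ s, (1 + hS.1.eigenvalues i) := by
    intro s
    induction s using Finset.induction_on with
    | empty => simp
    | insert a s ha ih =>
      rw [Finset.sum_insert ha, Finset.prod_insert ha]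
      have h1 := hS.eigenvalues_nonneg a
      have h2 : 0 ≤ ∑ i ∈ s, hS.1.eigenvalues i :=
        Finset.sum_nonneg fun i _ ↦ hS.eigenvalues_nonneg i
      nlinarith
  exact this _

/-- Simultaneous reduction of a positive definite form and a larger form. -/
theorem exists_posSemidef_whitening (hG : G.PosDef) (hQ : (Q - G).PosSemidef) :
    ∃ B S : Matrix (Fin n) (Fin n) ℝ, IsUnit B.det ∧ S.PosSemidef ∧ G = B.conjTranspose * B ∧
      Q = B.conjTranspose * (1 + S) * B := by
  obtain ⟨m, hm⟩ : ∃ B : Matrix (Fin n) (Fin n) ℝ, IsUnit B.det ∧ G = B.conjTranspose * B := by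
    open scoped MatrixOrder Matrix.Norms.L2Operator in
    obtain ⟨y, hy, hGy⟩ := CStarAlgebra.isStrictlyPositive_iff_eq_star_mul_self.1
      hG.isStrictlyPositive
    exact ⟨y, (isUnit_iff_isUnit_det y).1 hy, hGy⟩
  obtain ⟨hB, hGB⟩ := hm
  have hB' : IsUnit m.conjTranspose.det := by simpa using hB
  -- S is the excess Q - G expressed in a G-orthonormal frame.
  refine ⟨m, (m⁻¹).conjTranspose * (Q - G) * m⁻¹, hB, hQ.conjTranspose_mul_mul_same _, hGB, ?_⟩
  rw [Matrix.mul_add, Matrix.add_mul, Matrix.mul_one, ← hGB, conjTranspose_nonsing_inv,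
    Matrix.mul_assoc m.conjTranspose⁻¹, mul_nonsing_inv_cancel_left _ _ hB',
    nonsing_inv_mul_cancel_right _ _ hB]
  abel

/-- In a G-orthonormal frame the trace is n + tr S with S ≥ 0, and a positive semidefinite S of
trace zero vanishes. -/
theorem eq_of_trace_inv_mul_le (hG : G.PosDef) (hQ : (Q - G).PosSemidef)
    (h : (G⁻¹ * Q).trace ≤ n) : Q = G := by
  obtain ⟨B, S, hB, hS, rfl, rfl⟩ := exists_posSemidef_whitening hG hQ
  have hB' : IsUnit B.conjTranspose.det := by simpa using hB
  have htr : ((B.conjTranspose * B)⁻¹ * (B.conjTranspose * (1 + S) * B)).trace = n + S.trace := by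
    rw [Matrix.mul_inv_rev, Matrix.mul_assoc B.conjTranspose, Matrix.mul_assoc,
      nonsing_inv_mul_cancel_left _ _ hB', trace_mul_comm, mul_nonsing_inv_cancel_right _ _ hB]
    simp
  have h0 : S = 0 := hS.trace_eq_zero_iff.1 (le_antisymm (by linarith) hS.trace_nonneg)
  simp [h0]

/-- The ratio of determinants is det(1 + S) ≥ 1 + tr S, so tr S = 0. -/
theorem eq_of_det_le (hG : G.PosDef) (hQ : (Q - G).PosSemidef) (h : Q.det ≤ G.det) : Q = G := by
  have hGdet := hG.det_pos
  obtain ⟨B, S, hB, hS, rfl, rfl⟩ := exists_posSemidef_whitening hG hQ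
  have h1 : (B.conjTranspose * (1 + S) * B).det = (B.conjTranspose * B).det * (1 + S).det := by
    simp only [det_mul]
    ring
  have h2 : (1 + S).det ≤ 1 := by
    rw [h1] at h
    exact le_of_mul_le_mul_left (by simpa using h) hGdet
  have h0 : S = 0 := hS.trace_eq_zero_iff.1
    (le_antisymm (by linarith [one_add_trace_le_det_one_add hS]) hS.trace_nonneg)
  simp [h0]

end LinearAlgebra

/-! ### Passage between the manifolds and their charts. -/

section Charts

variable {n : ℕ} {M N : Type*} [TopologicalSpace M] [ChartedSpace (E n) M] [IsManifold (𝓡 n) ∞ M]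
  [TopologicalSpace N] [ChartedSpace (E n) N] [IsManifold (𝓡 n) ∞ N]

instance isManifold_one : IsManifold (𝓡 n) 1 M := IsManifold.of_le (n := ∞) (by simp)

/-- The derivative of the inverse of a chart, as an endomorphism of the model space. -/
def chartFrame (p : M) (u : E n) : E n →L[ℝ] E n :=
  mfderiv 𝓘(ℝ, E n) (𝓡 n) (extChartAt (𝓡 n) p).symm u

/-- A metric as a family of bilinear forms on the model space. -/
def form (g : Metric n M) (x : M) : E n →L[ℝ] E n →L[ℝ] ℝ := g.inner x

/-- The coordinate expression of a map in the preferred charts around `p` and `q`. -/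
def coordMap (f : M → N) (p : M) (q : N) (u : E n) : E n :=
  extChartAt (𝓡 n) q (f ((extChartAt (𝓡 n) p).symm u))

/-- The differential of a map, as an endomorphism of the model space. -/
def diff (f : M → N) (x : M) : E n →L[ℝ] E n := mfderiv (𝓡 n) (𝓡 n) f x

/-- The matrix of a bilinear form in the images of the standard basis under a linear map. -/
def formMatrix (β : E n →L[ℝ] E n →L[ℝ] ℝ) (L : E n →L[ℝ] E n) : Matrix (Fin n) (Fin n) ℝ :=
  Matrix.of fun i j ↦ β (L (EuclideanSpace.single i 1)) (L (EuclideanSpace.single j 1))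

/-- The matrix of a linear endomorphism of the model space. -/
def stdMatrix (L : E n →L[ℝ] E n) : Matrix (Fin n) (Fin n) ℝ :=
  Matrix.of fun a i ↦ L (EuclideanSpace.single i 1) a

theorem apply_single_eq_sum (L : E n →L[ℝ] E n) (i : Fin n) :
    L (EuclideanSpace.single i 1) =
      ∑ a, stdMatrix L a i • EuclideanSpace.single a (1 : ℝ) := by
  ext b
  simp [stdMatrix, Pi.single_apply]

theorem formMatrix_comp (β : E n →L[ℝ] E n →L[ℝ] ℝ) (L K : E n →L[ℝ] E n) :
    formMatrix β (L.comp K) = (stdMatrix K).transpose * formMatrix β L * stdMatrix K := by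
  ext i j
  simp only [formMatrix, Matrix.of_apply, ContinuousLinearMap.comp_apply, apply_single_eq_sum K,
    map_sum, map_smul, sum_apply, smul_apply, smul_eq_mul, Matrix.mul_apply,
    Matrix.transpose_apply, Finset.sum_mul, Finset.mul_sum]
  exact Finset.sum_congr rfl fun a _ ↦ Finset.sum_congr rfl fun b _ ↦ by ring

theorem stdMatrix_fderiv {φ : E n → E n} {u : E n} (hφ : DifferentiableAt ℝ φ u) :
    stdMatrix (fderiv ℝ φ u) = jac φ u := by
  ext a i
  exact fderiv_single_apply hφ a i

theorem gram_eq_formMatrix (g : Metric n M) (p : M) (u : E n) :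
    gram g p u = formMatrix (form g ((extChartAt (𝓡 n) p).symm u)) (chartFrame p u) := rfl

theorem contMDiffAt_extChartAt_symm (p : M) {u : E n} (hu : u ∈ (extChartAt (𝓡 n) p).target) :
    ContMDiffAt 𝓘(ℝ, E n) (𝓡 n) ∞ (extChartAt (𝓡 n) p).symm u :=
  (contMDiffOn_extChartAt_symm p).contMDiffAt ((isOpen_extChartAt_target p).mem_nhds hu)

theorem chartFrame_injective (p : M) {u : E n} (hu : u ∈ (extChartAt (𝓡 n) p).target) :
    Function.Injective (chartFrame p u) := by
  have h := mfderiv_extChartAt_comp_mfderivWithin_extChartAt_symm (I := 𝓡 n) hu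
  rw [ModelWithCorners.range_eq_univ, mfderivWithin_univ] at h
  intro v w hvw
  have h1 := congrArg (fun L ↦ L v) h
  have h2 := congrArg (fun L ↦ L w) h
  exact h1.symm.trans ((congrArg (mfderiv (𝓡 n) 𝓘(ℝ, E n) (extChartAt (𝓡 n) p)
    ((extChartAt (𝓡 n) p).symm u)) hvw).trans h2)

/-- The coordinate frame is the image of constant vector fields under the tangent map of the inverse
chart, hence smooth. Applying the metric gives a section of the trivial line bundle, from which the
function is read off. -/
theorem smoothMat_gram (g : Metric n M) (p : M) {u : E n}
    (hu : u ∈ (extChartAt (𝓡 n) p).target) : SmoothMat (gram g p) u := by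
  have hopen := isOpen_extChartAt_target (I := 𝓡 n) p
  have hframe : ∀ i : Fin n, ContMDiffAt 𝓘(ℝ, E n) (𝓡 n).tangent ∞
      (fun w : E n ↦ (⟨(extChartAt (𝓡 n) p).symm w,
        mfderiv 𝓘(ℝ, E n) (𝓡 n) (extChartAt (𝓡 n) p).symm w (EuclideanSpace.single i 1)⟩ :
          TangentBundle (𝓡 n) M)) u := by
    intro i
    have h1 : ContMDiffOn 𝓘(ℝ, E n).tangent (𝓡 n).tangent ∞
        (tangentMapWithin 𝓘(ℝ, E n) (𝓡 n) (extChartAt (𝓡 n) p).symm (extChartAt (𝓡 n) p).target)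
        (Bundle.TotalSpace.proj ⁻¹' (extChartAt (𝓡 n) p).target) :=
      (contMDiffOn_extChartAt_symm (n := ∞) p).contMDiffOn_tangentMapWithin (by simp)
        hopen.uniqueMDiffOn
    have h2 : ContMDiff 𝓘(ℝ, E n) 𝓘(ℝ, E n).tangent ∞ (fun w : E n ↦
        (⟨w, EuclideanSpace.single i 1⟩ : TangentBundle 𝓘(ℝ, E n) (E n))) :=
      contMDiff_vectorSpace_iff_contDiff.2 contDiff_const
    have h3 := h1.comp (s := (extChartAt (𝓡 n) p).target) h2.contMDiffOn (fun w hw ↦ hw)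
    refine (h3.contMDiffAt (hopen.mem_nhds hu)).congr_of_eventuallyEq ?_
    filter_upwards [hopen.mem_nhds hu] with w hw
    simp only [Function.comp_apply, tangentMapWithin]
    rw [mfderivWithin_of_isOpen hopen hw]
  intro i j
  have hbase := contMDiffAt_extChartAt_symm p hu
  have : ContMDiffAt 𝓘(ℝ, E n) ((𝓡 n).prod 𝓘(ℝ)) ∞
      (fun w ↦ Bundle.TotalSpace.mk' ℝ (E := Bundle.Trivial M ℝ) ((extChartAt (𝓡 n) p).symm w)
        (gram g p w i j)) u := by
    apply ContMDiffAt.clm_bundle_apply₂ (F₁ := E n) (F₂ := E n) (F₃ := ℝ) (B := M)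
      (E₁ := fun x : M ↦ TangentSpace (𝓡 n) x) (E₂ := fun x : M ↦ TangentSpace (𝓡 n) x)
      (E₃ := Bundle.Trivial M ℝ) (b := (extChartAt (𝓡 n) p).symm)
      (ψ := fun w ↦ g.inner ((extChartAt (𝓡 n) p).symm w))
      (v := fun w ↦ mfderiv 𝓘(ℝ, E n) (𝓡 n) (extChartAt (𝓡 n) p).symm w
        (EuclideanSpace.single i 1))
      (w := fun w ↦ mfderiv 𝓘(ℝ, E n) (𝓡 n) (extChartAt (𝓡 n) p).symm w
        (EuclideanSpace.single j 1))
    · exact g.contMDiff.contMDiffAt.comp u hbase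
    · exact hframe i
    · exact hframe j
  rw [Bundle.contMDiffAt_totalSpace] at this
  exact contMDiffAt_iff_contDiffAt.1 this.2

theorem sum_smul_single (v : Fin n → ℝ) :
    (∑ i, v i • EuclideanSpace.single i (1 : ℝ) : E n) = WithLp.toLp 2 v := by
  ext i
  simp [Pi.single_apply]

theorem dotProduct_formMatrix_mulVec (β : E n →L[ℝ] E n →L[ℝ] ℝ) (L : E n →L[ℝ] E n)
    (v w : Fin n → ℝ) :
    v ⬝ᵥ (formMatrix β L).mulVec w = β (L (WithLp.toLp 2 v)) (L (WithLp.toLp 2 w)) := by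
  rw [← sum_smul_single, ← sum_smul_single]
  simp only [dotProduct, Matrix.mulVec, formMatrix, Matrix.of_apply, map_sum, map_smul,
    sum_apply, smul_apply, smul_eq_mul, Finset.mul_sum]
  rw [Finset.sum_comm]
  exact Finset.sum_congr rfl fun _ _ ↦ Finset.sum_congr rfl fun _ _ ↦ by ring

theorem posDef_formMatrix (g : Metric n M) (x : M) {L : E n →L[ℝ] E n}
    (hL : Function.Injective L) : (formMatrix (form g x) L).PosDef := by
  rw [Matrix.posDef_iff_dotProduct_mulVec]
  refine ⟨?_, fun v hv ↦ ?_⟩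
  · ext i j
    exact g.symm x _ _
  · rw [star_trivial, dotProduct_formMatrix_mulVec]
    refine g.pos x _ fun h0 ↦ hv ?_
    have h1 : (WithLp.toLp 2 v : E n) = 0 := hL (h0.trans (map_zero L).symm)
    exact (WithLp.toLp_eq_zero 2).1 h1

theorem posDef_gram (g : Metric n M) (p : M) {u : E n} (hu : u ∈ (extChartAt (𝓡 n) p).target) :
    (gram g p u).PosDef :=
  posDef_formMatrix g _ (chartFrame_injective p hu)

theorem isMetricNear_gram (g : Metric n M) (p : M) {u : E n}
    (hu : u ∈ (extChartAt (𝓡 n) p).target) : IsMetricNear (gram g p) u where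
  smooth := smoothMat_gram g p hu
  symm := Filter.Eventually.of_forall fun w ↦ by
    ext i j
    exact g.symm _ _ _
  det_ne := (posDef_gram g p hu).det_pos.ne'

variable {f : M → N}

theorem contDiffAt_coordMap (hf : ContMDiff (𝓡 n) (𝓡 n) ∞ f) {p : M} {q : N} {u : E n}
    (hu : u ∈ (extChartAt (𝓡 n) p).target)
    (hq : f ((extChartAt (𝓡 n) p).symm u) ∈ (extChartAt (𝓡 n) q).source) :
    ContDiffAt ℝ ∞ (coordMap f p q) u := by
  rw [← contMDiffAt_iff_contDiffAt]
  rw [extChartAt_source] at hq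
  exact (contMDiffAt_extChartAt' hq).comp u
    (hf.contMDiffAt.comp u (contMDiffAt_extChartAt_symm p hu))

omit [IsManifold (𝓡 n) ∞ N] in
theorem eventually_mem_chart_domain (hf : Continuous f) {p : M} {q : N} {u : E n}
    (hu : u ∈ (extChartAt (𝓡 n) p).target)
    (hq : f ((extChartAt (𝓡 n) p).symm u) ∈ (extChartAt (𝓡 n) q).source) :
    ∀ᶠ w in 𝓝 u, w ∈ (extChartAt (𝓡 n) p).target ∧
      f ((extChartAt (𝓡 n) p).symm w) ∈ (extChartAt (𝓡 n) q).source := by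
  have h1 := (isOpen_extChartAt_target (I := 𝓡 n) p).mem_nhds hu
  have h2 : ContinuousAt (fun w ↦ f ((extChartAt (𝓡 n) p).symm w)) u :=
    hf.continuousAt.comp (contMDiffAt_extChartAt_symm p hu).continuousAt
  filter_upwards [h1, h2.preimage_mem_nhds ((isOpen_extChartAt_source (I := 𝓡 n) q).mem_nhds hq)]
    with w hw1 hw2 using ⟨hw1, hw2⟩

/-- The chain rule on both sides of f ∘ x_p⁻¹ = x_q⁻¹ ∘ (coordinate expression of f), valid near u.
-/
theorem diff_comp_chartFrame (hf : ContMDiff (𝓡 n) (𝓡 n) ∞ f) {p : M} {q : N} {u : E n}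
    (hu : u ∈ (extChartAt (𝓡 n) p).target)
    (hq : f ((extChartAt (𝓡 n) p).symm u) ∈ (extChartAt (𝓡 n) q).source) :
    (diff f ((extChartAt (𝓡 n) p).symm u)).comp (chartFrame p u) =
      (chartFrame q (coordMap f p q u)).comp (fderiv ℝ (coordMap f p q) u) := by
  have hφ := contDiffAt_coordMap hf hu hq
  have hsymm := (contMDiffAt_extChartAt_symm p hu).mdifferentiableAt (by simp)
  have hfd : MDifferentiableAt (𝓡 n) (𝓡 n) f ((extChartAt (𝓡 n) p).symm u) :=
    hf.contMDiffAt.mdifferentiableAt (by simp)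
  have hqt : coordMap f p q u ∈ (extChartAt (𝓡 n) q).target := (extChartAt (𝓡 n) q).map_source hq
  have hqsymm := (contMDiffAt_extChartAt_symm q hqt).mdifferentiableAt (by simp)
  have hφd : MDifferentiableAt 𝓘(ℝ, E n) 𝓘(ℝ, E n) (coordMap f p q) u :=
    (hφ.differentiableAt (by simp)).mdifferentiableAt
  have heq : (f ∘ (extChartAt (𝓡 n) p).symm) =ᶠ[𝓝 u]
      ((extChartAt (𝓡 n) q).symm ∘ coordMap f p q) := by
    filter_upwards [eventually_mem_chart_domain hf.continuous hu hq] with w hw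
    exact ((extChartAt (𝓡 n) q).left_inv hw.2).symm
  have h1 := mfderiv_comp u hfd hsymm
  have h2 := mfderiv_comp u hqsymm hφd
  have h3 := heq.mfderiv_eq (I := 𝓘(ℝ, E n)) (I' := 𝓡 n)
  rw [mfderiv_eq_fderiv] at h2
  exact h1.symm.trans (h3.trans h2)

/-- The pull-back of a metric in coordinates. -/
theorem formMatrix_diff_comp_chartFrame (g : Metric n N)
    (hf : ContMDiff (𝓡 n) (𝓡 n) ∞ f) {p : M} {q : N} {u : E n} (hu : u ∈ (extChartAt (𝓡 n) p).target)
    (hq : f ((extChartAt (𝓡 n) p).symm u) ∈ (extChartAt (𝓡 n) q).source) :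
    formMatrix (form g (f ((extChartAt (𝓡 n) p).symm u)))
        ((diff f ((extChartAt (𝓡 n) p).symm u)).comp (chartFrame p u)) =
      (jac (coordMap f p q) u).transpose * gram g q (coordMap f p q u) *
        jac (coordMap f p q) u := by
  have hφ := contDiffAt_coordMap hf hu hq
  have hpt : (extChartAt (𝓡 n) q).symm (coordMap f p q u) = f ((extChartAt (𝓡 n) p).symm u) :=
    (extChartAt (𝓡 n) q).left_inv hq
  rw [diff_comp_chartFrame hf hu hq, formMatrix_comp, stdMatrix_fderiv
    (hφ.differentiableAt (by simp)), gram_eq_formMatrix, hpt]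

theorem gram_change (g : Metric n M) {p x : M} {u : E n} (hu : u ∈ (extChartAt (𝓡 n) p).target)
    (hx : (extChartAt (𝓡 n) p).symm u ∈ (extChartAt (𝓡 n) x).source) :
    gram g p u = (jac (coordMap id p x) u).transpose * gram g x (coordMap id p x u) *
        jac (coordMap id p x) u := by
  rw [← formMatrix_diff_comp_chartFrame g contMDiff_id hu hx, gram_eq_formMatrix]
  have : diff (id : M → M) ((extChartAt (𝓡 n) p).symm u) = ContinuousLinearMap.id ℝ (E n) :=
    mfderiv_id
  rw [this]
  rfl

/-- The two expressions differ by the order of the second partial derivatives and the arrangement of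
sums. -/
theorem covDerivDiff_eq_covM {gM : Metric n M} {gN : Metric n N}
    (hf : ContMDiff (𝓡 n) (𝓡 n) ∞ f) (p : M) (j : Fin n) :
    covDerivDiff gM gN f p j =
      covM (gram gM p) (gram gN (f p)) (coordMap f p (f p)) j (extChartAt (𝓡 n) p p) := by
  have hpt : f ((extChartAt (𝓡 n) p).symm (extChartAt (𝓡 n) p p)) = f p := by
    rw [extChartAt_to_inv]
  have hφ : ContDiffAt ℝ ∞ (coordMap f p (f p)) (extChartAt (𝓡 n) p p) :=
    contDiffAt_coordMap hf (mem_extChartAt_target p) (by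
      rw [hpt]; exact mem_extChartAt_source (f p))
  have hφp : coordMap f p (f p) (extChartAt (𝓡 n) p p) = extChartAt (𝓡 n) (f p) (f p) := by
    rw [coordMap, hpt]
  ext a i
  have h1 : pderiv i (pderiv j (mapComponent f p a)) (extChartAt (𝓡 n) p p) =
      dmat j (jac (coordMap f p (f p))) (extChartAt (𝓡 n) p p) a i :=
    dmat_jac_symm hφ i j a
  simp only [covDerivDiff, Matrix.of_apply, h1, covM, Matrix.add_apply, Matrix.sub_apply,
    Matrix.mul_apply, pullChr, hφp, Matrix.sum_apply, Matrix.smul_apply, smul_eq_mul,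
    Finset.sum_mul]
  congr 1
  · congr 1
    exact Finset.sum_congr rfl fun k _ ↦ mul_comm _ _
  · rw [Finset.sum_comm]
    refine Finset.sum_congr rfl fun c _ ↦ Finset.sum_congr rfl fun b _ ↦ ?_
    change christoffel gN (f p) a b c _ * jac (coordMap f p (f p)) _ b i *
      jac (coordMap f p (f p)) _ c j = jac (coordMap f p (f p)) _ c j *
      christoffel gN (f p) a b c _ * jac (coordMap f p (f p)) _ b i
    ring

/-- The tension field of a harmonic map vanishes in all charts. -/
theorem IsHarmonic.tension_eq_zero {gM : Metric n M} {gN : Metric n N}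
    (hharm : IsHarmonic gM gN f) (hf : ContMDiff (𝓡 n) (𝓡 n) ∞ f) {p : M} {q : N} {u : E n}
    (hu : u ∈ (extChartAt (𝓡 n) p).target)
    (hq : f ((extChartAt (𝓡 n) p).symm u) ∈ (extChartAt (𝓡 n) q).source) (a : Fin n) :
    tension (gram gM p) (gram gN q) (coordMap f p q) a u = 0 := by
  -- Harmonicity is given at x only in the preferred charts at x and f x, while the Bochner argument
  -- needs it near a point in one fixed pair of charts. The transition maps p → x and q → f x are
  -- isometries of the coordinate metrics and carry the vanishing over.
  set x := (extChartAt (𝓡 n) p).symm u with hx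
  have hxs : x ∈ (extChartAt (𝓡 n) x).source := mem_extChartAt_source x
  have hfxs : f x ∈ (extChartAt (𝓡 n) (f x)).source := mem_extChartAt_source (f x)
  have hψu : coordMap id p x u = extChartAt (𝓡 n) x x := rfl
  have hxt : coordMap id p x u ∈ (extChartAt (𝓡 n) x).target := mem_extChartAt_target x
  have hxx : (extChartAt (𝓡 n) x).symm (coordMap id p x u) = x := extChartAt_to_inv x
  have hφu : coordMap f p q u ∈ (extChartAt (𝓡 n) q).target := (extChartAt (𝓡 n) q).map_source hq
  have hqq : (extChartAt (𝓡 n) q).symm (coordMap f p q u) = f x := (extChartAt (𝓡 n) q).left_inv hq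
  have hqx : id ((extChartAt (𝓡 n) q).symm (coordMap f p q u)) ∈
      (extChartAt (𝓡 n) (f x)).source := by rw [hqq]; exact hfxs
  have hfx : f ((extChartAt (𝓡 n) x).symm (coordMap id p x u)) ∈
      (extChartAt (𝓡 n) (f x)).source := by rw [hxx]; exact hfxs
  have hχu : coordMap id q (f x) (coordMap f p q u) ∈ (extChartAt (𝓡 n) (f x)).target :=
    (extChartAt (𝓡 n) (f x)).map_source hqx
  have ev1 := eventually_mem_chart_domain hf.continuous hu hq
  have ev2 := eventually_mem_chart_domain continuous_id hu (q := x) hxs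
  have ev3 := eventually_mem_chart_domain continuous_id hφu hqx
  have ev4 := eventually_mem_chart_domain hf.continuous hxt hfx
  refine tension_eq_zero_of_change (G' := gram gM x) (H' := gram gN (f x))
    (φ' := coordMap f x (f x)) (ψ := coordMap id p x) (χ := coordMap id q (f x))
    (isMetricNear_gram gM p hu) (isMetricNear_gram gM x hxt) (isMetricNear_gram gN q hφu)
    (isMetricNear_gram gN (f x) hχu) (ev1.mono fun w hw ↦ contDiffAt_coordMap hf hw.1 hw.2)
    (ev2.mono fun w hw ↦ contDiffAt_coordMap contMDiff_id hw.1 hw.2)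
    (ev3.mono fun w hw ↦ contDiffAt_coordMap contMDiff_id hw.1 hw.2)
    (ev4.mono fun w hw ↦ contDiffAt_coordMap hf hw.1 hw.2) ?_
    (ev2.mono fun w hw ↦ gram_change gM hw.1 hw.2) (ev3.mono fun w hw ↦ gram_change gN hw.1 hw.2)
    (fun b ↦ ?_) a
  · filter_upwards [ev1, ev2] with w h1 h2
    have e1 : (extChartAt (𝓡 n) q).symm (coordMap f p q w) = f ((extChartAt (𝓡 n) p).symm w) :=
      (extChartAt (𝓡 n) q).left_inv h1.2
    have e2 : (extChartAt (𝓡 n) x).symm (coordMap id p x w) = (extChartAt (𝓡 n) p).symm w :=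
      (extChartAt (𝓡 n) x).left_inv h2.2
    rw [coordMap, e1, coordMap, e2]
    rfl
  · rw [← hharm x b, tension, hψu]
    refine Finset.sum_congr rfl fun i _ ↦ Finset.sum_congr rfl fun j _ ↦ ?_
    rw [covDerivDiff_eq_covM hf]

end Charts

/-! ### Expansive maps, the maximum of the Jacobian, and the local isometry. -/

section Rigidity

variable {n : ℕ} {M N : Type*} [TopologicalSpace M] [ChartedSpace (E n) M] [IsManifold (𝓡 n) ∞ M]
  [TopologicalSpace N] [ChartedSpace (E n) N] [IsManifold (𝓡 n) ∞ N]
  {gM : Metric n M} {gN : Metric n N} {f : M → N}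

/-! ### Expansive maps -/

theorem form_self_nonneg (g : Metric n M) (x : M) (v : E n) : 0 ≤ form g x v v := by
  by_cases hv : v = 0
  · simp [hv]
  · exact (g.pos x v hv).le

theorem IsOneExpansive.form_le (hexp : IsOneExpansive gM gN f) (x : M) (v : E n) :
    form gM x v v ≤ form gN (f x) (diff f x v) (diff f x v) :=
  (Real.sqrt_le_sqrt_iff (form_self_nonneg gN (f x) (diff f x v))).1 (hexp x v)

theorem IsOneExpansive.diff_injective (hexp : IsOneExpansive gM gN f) (x : M) :
    Function.Injective (diff (n := n) f x) := by
  refine (injective_iff_map_eq_zero _).2 fun v hv ↦ ?_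
  by_contra hne
  have h1 := hexp.form_le x v
  have h2 : 0 < form gM x v v := gM.pos x v hne
  rw [hv] at h1
  simp only [map_zero] at h1
  linarith

theorem IsOneExpansive.posSemidef_sub (hexp : IsOneExpansive gM gN f) (x : M)
    (L : E n →L[ℝ] E n) :
    (formMatrix (form gN (f x)) ((diff f x).comp L) - formMatrix (form gM x) L).PosSemidef := by
  refine Matrix.PosSemidef.of_dotProduct_mulVec_nonneg ?_ fun v ↦ ?_
  · ext i j
    exact congrArg₂ (· - ·) (gN.symm _ _ _) (gM.symm _ _ _)
  · rw [star_trivial, Matrix.sub_mulVec, dotProduct_sub, dotProduct_formMatrix_mulVec,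
      dotProduct_formMatrix_mulVec]
    exact sub_nonneg.2 (hexp.form_le x _)

/-! ### The squared Jacobian -/

/-- The squared Jacobian determinant of `f`. -/
def jacobianSq (gM : Metric n M) (gN : Metric n N) (f : M → N) (x : M) : ℝ :=
  (formMatrix (form gN (f x)) (diff f x)).det /
    (formMatrix (form gM x) (ContinuousLinearMap.id ℝ (E n))).det

/-- A change of frame multiplies numerator and denominator by the same det(L)². -/
theorem jacobianSq_eq_div (gM : Metric n M) (gN : Metric n N) (f : M → N) (x : M)
    {L : E n →L[ℝ] E n} (hL : Function.Injective L) :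
    jacobianSq gM gN f x = (formMatrix (form gN (f x)) ((diff f x).comp L)).det /
      (formMatrix (form gM x) L).det := by
  have h1 : formMatrix (form gM x) L = (stdMatrix L).transpose *
      formMatrix (form gM x) (ContinuousLinearMap.id ℝ (E n)) * stdMatrix L := by
    rw [← formMatrix_comp, ContinuousLinearMap.id_comp]
  have hdet : (stdMatrix L).det ≠ 0 := fun h ↦
    (posDef_formMatrix gM x hL).det_pos.ne' (by rw [h1]; simp [h])
  rw [h1, formMatrix_comp, jacobianSq]
  simp only [Matrix.det_mul, Matrix.det_transpose]
  field_simp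

theorem jacobianSq_symm_eq (gM : Metric n M) (gN : Metric n N)
    (hf : ContMDiff (𝓡 n) (𝓡 n) ∞ f) {p : M} {q : N} {u : E n}
    (hu : u ∈ (extChartAt (𝓡 n) p).target)
    (hq : f ((extChartAt (𝓡 n) p).symm u) ∈ (extChartAt (𝓡 n) q).source) :
    jacobianSq gM gN f ((extChartAt (𝓡 n) p).symm u) =
      ((jac (coordMap f p q) u).transpose * gram gN q (coordMap f p q u) *
        jac (coordMap f p q) u).det / (gram gM p u).det := by
  rw [jacobianSq_eq_div gM gN f _ (chartFrame_injective p hu),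
    formMatrix_diff_comp_chartFrame gN hf hu hq]
  rfl

/-- The model basis of the tangent space at x depends on the preferred chart at x and may jump, so
continuity is read off in charts fixed at p. -/
theorem continuous_jacobianSq (gM : Metric n M) (gN : Metric n N)
    (hf : ContMDiff (𝓡 n) (𝓡 n) ∞ f) : Continuous (jacobianSq gM gN f) := by
  rw [continuous_iff_continuousAt]
  intro p
  have hu : extChartAt (𝓡 n) p p ∈ (extChartAt (𝓡 n) p).target := mem_extChartAt_target p
  have hpt : (extChartAt (𝓡 n) p).symm (extChartAt (𝓡 n) p p) = p := extChartAt_to_inv p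
  have hq : f ((extChartAt (𝓡 n) p).symm (extChartAt (𝓡 n) p p)) ∈
      (extChartAt (𝓡 n) (f p)).source := by rw [hpt]; exact mem_extChartAt_source (f p)
  have hφ := contDiffAt_coordMap hf hu hq
  have hφu : coordMap f p (f p) (extChartAt (𝓡 n) p p) ∈ (extChartAt (𝓡 n) (f p)).target :=
    (extChartAt (𝓡 n) (f p)).map_source hq
  have hJ := smoothMat_jac hφ
  have hG := isMetricNear_gram gM p hu
  have hloc : ContinuousAt (fun u ↦ ((jac (coordMap f p (f p)) u).transpose *
      gram gN (f p) (coordMap f p (f p) u) * jac (coordMap f p (f p)) u).det /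
        (gram gM p u).det) (extChartAt (𝓡 n) p p) :=
    ((hJ.transpose.mul ((smoothMat_gram gN (f p) hφu).comp hφ)).mul hJ).det.continuousAt.div
      hG.smooth.det.continuousAt hG.det_ne
  refine (ContinuousAt.comp (f := extChartAt (𝓡 n) p) hloc
    (continuousAt_extChartAt p)).congr ?_
  have ev := (continuousAt_extChartAt (I := 𝓡 n) p).eventually
    (eventually_mem_chart_domain hf.continuous hu hq)
  filter_upwards [ev, extChartAt_source_mem_nhds (I := 𝓡 n) p] with x hx hxs
  have hx' : (extChartAt (𝓡 n) p).symm (extChartAt (𝓡 n) p x) = x :=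
    (extChartAt (𝓡 n) p).left_inv hxs
  have := jacobianSq_symm_eq gM gN hf hx.1 hx.2
  rw [hx'] at this
  exact this.symm

/-- At a maximum of its Jacobian, an expansive harmonic map into a negative Einstein manifold is
infinitesimally isometric. -/
theorem jacobianSq_eq_one_of_max {Rstar : ℝ} (hR : Rstar < 0) (hEinstein : IsEinstein gN)
    (hScN : ∀ y : N, scalarCurvature gN y = Rstar)
    (hScM : ∀ x : M, Rstar ≤ scalarCurvature gM x)
    (hf : ContMDiff (𝓡 n) (𝓡 n) ∞ f) (hexp : IsOneExpansive gM gN f)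
    (hharm : IsHarmonic gM gN f) (hC : ∀ x : M, invariantC gM gN f x ≤ 0) {p : M}
    (hmax : ∀ x, jacobianSq gM gN f x ≤ jacobianSq gM gN f p) :
    jacobianSq gM gN f p = 1 := by
  set u := extChartAt (𝓡 n) p p with hu_def
  set φ := coordMap (n := n) f p (f p) with hφ_def
  set G := gram gM p with hG_def
  set H := gram gN (f p) with hH_def
  have hu : u ∈ (extChartAt (𝓡 n) p).target := mem_extChartAt_target p
  have hpt : (extChartAt (𝓡 n) p).symm u = p := extChartAt_to_inv p
  have hq : f ((extChartAt (𝓡 n) p).symm u) ∈ (extChartAt (𝓡 n) (f p)).source := by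
    rw [hpt]; exact mem_extChartAt_source (f p)
  have hφp : φ u = extChartAt (𝓡 n) (f p) (f p) := by rw [hφ_def, coordMap, hpt]
  have hφu : φ u ∈ (extChartAt (𝓡 n) (f p)).target := (extChartAt (𝓡 n) (f p)).map_source hq
  have ev := eventually_mem_chart_domain hf.continuous hu hq
  have hGpos : (G u).PosDef := posDef_gram gM p hu
  have hHpos : (H (φ u)).PosDef := posDef_gram gN (f p) hφu
  have hQ : ∀ w, w ∈ (extChartAt (𝓡 n) p).target →
      f ((extChartAt (𝓡 n) p).symm w) ∈ (extChartAt (𝓡 n) (f p)).source →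
      ((jac φ w).transpose * H (φ w) * jac φ w).PosDef := fun w h1 h2 ↦ by
    rw [← formMatrix_diff_comp_chartFrame gN hf h1 h2]
    exact posDef_formMatrix gN _ ((hexp.diff_injective _).comp (chartFrame_injective p h1))
  have hdet : (jac φ u).det ≠ 0 := fun h ↦ (hQ u hu hq).det_pos.ne' (by simp [h])
  have hlocmax : IsLocalMax (fun w ↦ Real.log ((jac φ w).transpose * H (φ w) * jac φ w).det
      - Real.log (G w).det) u := by
    filter_upwards [ev] with w hw
    have hpos : ∀ w, w ∈ (extChartAt (𝓡 n) p).target →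
        f ((extChartAt (𝓡 n) p).symm w) ∈ (extChartAt (𝓡 n) (f p)).source →
        0 < jacobianSq gM gN f ((extChartAt (𝓡 n) p).symm w) ∧
        Real.log ((jac φ w).transpose * H (φ w) * jac φ w).det - Real.log (G w).det =
          Real.log (jacobianSq gM gN f ((extChartAt (𝓡 n) p).symm w)) := fun w h1 h2 ↦ by
      have hd1 := (hQ w h1 h2).det_pos
      have hd2 : 0 < (G w).det := (posDef_gram gM p h1).det_pos
      rw [jacobianSq_symm_eq gM gN hf h1 h2]
      exact ⟨div_pos hd1 hd2, (Real.log_div hd1.ne' hd2.ne').symm⟩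
    rw [(hpos w hw.1 hw.2).2, (hpos u hu hq).2, hpt]
    exact Real.log_le_log (hpos w hw.1 hw.2).1 (hmax _)
  have hineq := curvature_inequality_of_isLocalMax (G := G) (H := H) (φ := φ)
    (ev.mono fun w hw ↦ isMetricNear_gram gM p hw.1) hGpos
    (ev.mono fun w hw ↦ contDiffAt_coordMap hf hw.1 hw.2)
    (Filter.mem_of_superset ((isOpen_extChartAt_target (I := 𝓡 n) (f p)).mem_nhds hφu)
      fun w hw ↦ isMetricNear_gram gN (f p) hw) hdet
    (ev.mono fun w hw a ↦ hharm.tension_eq_zero hf hw.1 hw.2 a) hlocmax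
  set J := jac φ u with hJ_def
  set Q := J.transpose * H (φ u) * J with hQ_def
  obtain ⟨c, hc⟩ := hEinstein
  have hricN : ricM H (φ u) = c • H (φ u) := by
    rw [hφp]; exact hc (f p)
  have hGinv_symm : ((G u)⁻¹).transpose = (G u)⁻¹ := hGpos.inv.isHermitian
  -- Trace of the Einstein equation.
  have hcn : c * n = Rstar := by
    have hHs : ((H (φ u))⁻¹).transpose = (H (φ u))⁻¹ := hHpos.inv.isHermitian
    rw [← hScN (f p), scalarCurvature]
    have h1 : ∀ j k, ricci gN (f p) j k = c * H (φ u) j k := fun j k ↦ by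
      rw [hc (f p), hφp]; rfl
    simp only [h1, ← hφp]
    change _ = ∑ j, ∑ k, (H (φ u))⁻¹ j k * (c * H (φ u) j k)
    have h2 : ((H (φ u))⁻¹.transpose * H (φ u)).trace = n := by
      rw [hHs, Matrix.nonsing_inv_mul _ (Ne.isUnit hHpos.det_pos.ne')]
      simp
    rw [← h2]
    simp only [Matrix.trace, Matrix.diag, Matrix.mul_apply, Matrix.transpose_apply, Finset.mul_sum]
    rw [Finset.sum_comm]
    exact Finset.sum_congr rfl fun _ _ ↦ Finset.sum_congr rfl fun _ _ ↦ by ring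
  have hricterm : ∑ l, ∑ j, (G u)⁻¹ l j * (J.transpose * ricM H (φ u) * J) l j =
      c * ((G u)⁻¹ * Q).trace := by
    have h1 : J.transpose * ricM H (φ u) * J = c • Q := by
      rw [hricN, Matrix.mul_smul, Matrix.smul_mul]
    have h2 : ((G u)⁻¹ * Q).trace = ((G u)⁻¹.transpose * Q).trace := by rw [hGinv_symm]
    rw [h1, h2]
    simp only [Matrix.trace, Matrix.diag, Matrix.mul_apply, Matrix.transpose_apply, Finset.mul_sum,
      Matrix.smul_apply, smul_eq_mul]
    rw [Finset.sum_comm]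
    exact Finset.sum_congr rfl fun _ _ ↦ Finset.sum_congr rfl fun _ _ ↦ by ring
  -- Since adj J = det(J) J⁻¹, the invariant C is this sum times the positive factor (det H / det G)
  -- det(J)² = V.
  have hCterm : ∑ l, ∑ j, (G u)⁻¹ l j *
      (J⁻¹ * covM G H φ l u * J⁻¹ * covM G H φ j u).trace ≤ 0 := by
    have hadj : J.adjugate = J.det • J⁻¹ := by
      rw [Matrix.inv_def, Ring.inverse_eq_inv', smul_smul, mul_inv_cancel₀ hdet, one_smul]
    have h1 : invariantC gM gN f p = (H (φ u)).det / (G u).det * J.det ^ 2 *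
        ∑ l, ∑ j, (G u)⁻¹ l j * (J⁻¹ * covM G H φ l u * J⁻¹ * covM G H φ j u).trace := by
      have hj : jacobian f p = J := rfl
      simp only [invariantC, covDerivDiff_eq_covM hf, hj, hadj, ← hφp, Matrix.smul_mul,
        Matrix.mul_smul, Matrix.trace_smul, smul_eq_mul]
      rw [mul_assoc ((H (φ u)).det / (G u).det)]
      congr 1
      rw [Finset.mul_sum]
      refine Finset.sum_congr rfl fun l _ ↦ ?_
      rw [Finset.mul_sum]
      refine Finset.sum_congr rfl fun j _ ↦ ?_
      ring
    have h2 : 0 < (H (φ u)).det / (G u).det * J.det ^ 2 :=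
      mul_pos (div_pos hHpos.det_pos hGpos.det_pos) (by positivity)
    have h3 := hC p
    rw [h1] at h3
    exact nonpos_of_mul_nonpos_right h3 h2
  have hSc : Rstar ≤ ∑ l, ∑ j, (G u)⁻¹ l j * ricM G u l j := hScM p
  rw [hricterm] at hineq
  -- The inequality cn = R* ≤ Sc ≤ c tr(G⁻¹Q) reverses on division by c < 0.
  have htrace : ((G u)⁻¹ * Q).trace ≤ n := by
    have hcneg : c < 0 := by
      by_contra! hcn0
      have : 0 ≤ c * n := by positivity
      linarith
    nlinarith
  have hsub : (Q - G u).PosSemidef := by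
    have := hexp.posSemidef_sub ((extChartAt (𝓡 n) p).symm u) (chartFrame p u)
    rwa [formMatrix_diff_comp_chartFrame gN hf hu hq, ← gram_eq_formMatrix] at this
  have hQG : Q = G u := eq_of_trace_inv_mul_le hGpos hsub htrace
  have hfinal := jacobianSq_symm_eq gM gN hf hu hq
  rw [hpt] at hfinal
  rw [hfinal]
  change Q.det / (G u).det = 1
  rw [hQG, div_self hGpos.det_pos.ne']

/-! ### The inverse function theorem on manifolds -/

/-- In equal dimensions an injective differential is invertible, so the inverse function theorem
applies in charts. -/
theorem isLocalDiffeomorph_of_diff_injective (hf : ContMDiff (𝓡 n) (𝓡 n) ∞ f)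
    (hinj : ∀ x, Function.Injective (diff (n := n) f x)) : IsLocalDiffeomorph (𝓡 n) (𝓡 n) ∞ f := by
  intro p
  set u := extChartAt (𝓡 n) p p with hu_def
  set φ := coordMap (n := n) f p (f p) with hφ_def
  have hpt : (extChartAt (𝓡 n) p).symm u = p := extChartAt_to_inv p
  have hu : u ∈ (extChartAt (𝓡 n) p).target := mem_extChartAt_target p
  have hq : f ((extChartAt (𝓡 n) p).symm u) ∈ (extChartAt (𝓡 n) (f p)).source := by
    rw [hpt]; exact mem_extChartAt_source (f p)
  obtain ⟨U, hU, hUopen, huU⟩ := eventually_nhds_iff.1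
    (eventually_mem_chart_domain hf.continuous hu hq)
  have hsmooth : ∀ w ∈ U, ContDiffAt ℝ ∞ φ w := fun w hw ↦
    contDiffAt_coordMap hf (hU w hw).1 (hU w hw).2
  have hequiv : ∀ w ∈ U, ∃ e : E n ≃L[ℝ] E n, HasFDerivAt φ (e : E n →L[ℝ] E n) w := by
    intro w hw
    have hd := (hsmooth w hw).differentiableAt (by simp)
    have hinjw : Function.Injective (fderiv ℝ φ w) := by
      have h1 : Function.Injective ((diff (n := n) f ((extChartAt (𝓡 n) p).symm w)).comp
          (chartFrame p w)) := (hinj _).comp (chartFrame_injective p (hU w hw).1)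
      rw [diff_comp_chartFrame hf (hU w hw).1 (hU w hw).2] at h1
      exact Function.Injective.of_comp h1
    refine ⟨(LinearEquiv.ofInjectiveEndo (fderiv ℝ φ w : E n →ₗ[ℝ] E n)
      hinjw).toContinuousLinearEquiv, ?_⟩
    have : (((LinearEquiv.ofInjectiveEndo (fderiv ℝ φ w : E n →ₗ[ℝ] E n)
        hinjw).toContinuousLinearEquiv : E n ≃L[ℝ] E n) : E n →L[ℝ] E n) = fderiv ℝ φ w := by
      ext v
      rfl
    rw [this]
    exact hd.hasFDerivAt
  obtain ⟨e₀, he₀⟩ := hequiv u huU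
  -- On U the derivative is invertible at every point, so after restriction the inverse is smooth on
  -- its whole domain and not just at the image of u.
  set Φ := ((hsmooth u huU).toOpenPartialHomeomorph φ he₀ (by simp)).restrOpen U hUopen with hΦ
  have hΦsource : ∀ w ∈ Φ.source, w ∈ U := fun w hw ↦ hw.2
  have hΦu : u ∈ Φ.source :=
    ⟨(hsmooth u huU).mem_toOpenPartialHomeomorph_source he₀ (by simp), huU⟩
  have hΦcoe : ∀ w, Φ w = φ w := fun w ↦ rfl
  have hΦsymm : ContMDiffOn (𝓡 n) (𝓡 n) ∞ Φ.symm Φ.target := by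
    intro y hy
    have hx := hΦsource _ (Φ.map_target hy)
    obtain ⟨e, he⟩ := hequiv _ hx
    exact (contMDiffAt_iff_contDiffAt.2
      (Φ.contDiffAt_symm hy he (hsmooth _ hx))).contMDiffWithinAt
  set Ψ := ((chartAt (E n) p).trans Φ).trans (chartAt (E n) (f p)).symm with hΨ
  have hΨf : ∀ x ∈ Ψ.source, f x = Ψ x := by
    intro x hx
    have hxp : x ∈ (chartAt (E n) p).source := by simp [hΨ] at hx; exact hx.1.1
    have hxU : chartAt (E n) p x ∈ U := hΦsource _ (by simp [hΨ] at hx; exact hx.1.2)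
    have h1 : (extChartAt (𝓡 n) p).symm (chartAt (E n) p x) = x :=
      (extChartAt (𝓡 n) p).left_inv (by rwa [extChartAt_source])
    have h2 := (hU _ hxU).2
    rw [h1] at h2
    have h3 : Ψ x = (extChartAt (𝓡 n) (f p)).symm (φ (chartAt (E n) p x)) := rfl
    rw [h3, hφ_def, coordMap, h1]
    exact ((extChartAt (𝓡 n) (f p)).left_inv h2).symm
  have hΨsymm : ContMDiffOn (𝓡 n) (𝓡 n) ∞ Ψ.symm Ψ.target := by
    have h1 : ContMDiffOn (𝓡 n) (𝓡 n) ∞ (chartAt (E n) (f p)) (chartAt (E n) (f p)).source :=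
      contMDiffOn_chart
    have h2 : ContMDiffOn (𝓡 n) (𝓡 n) ∞ (chartAt (E n) p).symm (chartAt (E n) p).target :=
      contMDiffOn_chart_symm
    have h3 : ContMDiffOn (𝓡 n) (𝓡 n) ∞
        ((chartAt (E n) p).symm ∘ (Φ.symm ∘ chartAt (E n) (f p))) Ψ.target := by
      refine h2.comp (hΦsymm.comp (h1.mono fun y hy ↦ ?_) fun y hy ↦ ?_) fun y hy ↦ ?_
      · simp [hΨ] at hy; exact hy.1
      · simp [hΨ] at hy; exact hy.2.1
      · simp [hΨ] at hy; exact hy.2.2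
    exact h3
  refine ⟨⟨Ψ.toPartialEquiv, Ψ.open_source, Ψ.open_target,
    hf.contMDiffOn.congr fun x hx ↦ (hΨf x hx).symm, hΨsymm⟩, ?_, hΨf⟩
  have hchart : chartAt (E n) p p = u := rfl
  have hφu : φ u ∈ (chartAt (E n) (f p)).target := by
    have := (extChartAt (𝓡 n) (f p)).map_source hq
    simp [extChartAt] at this
    exact this
  change p ∈ Ψ.source
  simp only [hΨ, OpenPartialHomeomorph.trans_source, Set.mem_inter_iff, Set.mem_preimage,
    mem_chart_source, true_and, hchart, OpenPartialHomeomorph.symm_source]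
  exact ⟨hΦu, hφu⟩

theorem isLocalIsometry_of_jacobianSq_le_one (hf : ContMDiff (𝓡 n) (𝓡 n) ∞ f)
    (hexp : IsOneExpansive gM gN f) (hle : ∀ x, jacobianSq gM gN f x ≤ 1) :
    IsLocalIsometry gM gN f := by
  refine ⟨isLocalDiffeomorph_of_diff_injective hf hexp.diff_injective, fun x v w ↦ ?_⟩
  have hpos : (formMatrix (form gM x) (ContinuousLinearMap.id ℝ (E n))).PosDef :=
    posDef_formMatrix gM x Function.injective_id
  have heq : formMatrix (form gN (f x)) (diff f x) =
      formMatrix (form gM x) (ContinuousLinearMap.id ℝ (E n)) :=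
    eq_of_det_le hpos (hexp.posSemidef_sub x (ContinuousLinearMap.id ℝ (E n)))
      ((div_le_one hpos.det_pos).1 (hle x))
  have h1 := dotProduct_formMatrix_mulVec (form gN (f x)) (diff f x) (WithLp.ofLp v) (WithLp.ofLp w)
  rw [heq, dotProduct_formMatrix_mulVec] at h1
  exact h1.symm

end Rigidity

end EinsteinRigidity

end

theorem mainTheorem8 {n : ℕ} {M N : Type*}
    [TopologicalSpace M] [T2Space M] [CompactSpace M] [ChartedSpace (EinsteinRigidity.E n) M]
    [IsManifold (𝓡 n) ∞ M]
    [TopologicalSpace N] [T2Space N] [CompactSpace N] [ConnectedSpace N]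
    [ChartedSpace (EinsteinRigidity.E n) N] [IsManifold (𝓡 n) ∞ N]
    (oM : EinsteinRigidity.ManifoldOrientation n M)
    (oN : EinsteinRigidity.ManifoldOrientation n N)
    (gM : EinsteinRigidity.Metric n M) (gN : EinsteinRigidity.Metric n N)
    (Rstar : ℝ) (hR : Rstar < 0)
    (hEinstein : EinsteinRigidity.IsEinstein gN)
    (hScN : ∀ y : N, EinsteinRigidity.scalarCurvature gN y = Rstar)
    (hScM : ∀ x : M, Rstar ≤ EinsteinRigidity.scalarCurvature gM x)
    (f : M → N) (hf : ContMDiff (𝓡 n) (𝓡 n) ∞ f)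
    (d : ℤ) (hd : d ≠ 0) (hdeg : EinsteinRigidity.HasDegree oM oN f d)
    (hexp : EinsteinRigidity.IsOneExpansive gM gN f)
    (hharm : EinsteinRigidity.IsHarmonic gM gN f)
    (hC : ∀ x : M, EinsteinRigidity.invariantC gM gN f x ≤ 0) :
    EinsteinRigidity.IsLocalIsometry gM gN f := by
  refine EinsteinRigidity.isLocalIsometry_of_jacobianSq_le_one hf hexp fun x ↦ ?_
  -- The point x to be treated also provides the nonemptiness needed for a maximum.
  obtain ⟨p, -, hp⟩ := isCompact_univ.exists_isMaxOn ⟨x, Set.mem_univ x⟩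
    (EinsteinRigidity.continuous_jacobianSq gM gN hf).continuousOn
  have hmax : ∀ y, EinsteinRigidity.jacobianSq gM gN f y ≤ EinsteinRigidity.jacobianSq gM gN f p :=
    fun y ↦ hp (Set.mem_univ y)
  exact (hmax x).trans_eq
    (EinsteinRigidity.jacobianSq_eq_one_of_max hR hEinstein hScN hScM hf hexp hharm hC hmax)
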